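/- Let $N\ge 0$ be an integer, $\sigma\in\{i,-i\}$, $c\in\mathbb C$, and let $p_j,q_j,s_j\in\mathbb C$ $(1\le j\le N)$ with $p_j\ne 0$ and $p_j+p_k\neq 0$ for $j\ne k$. For real $x,z,t$ put $$\lambda_j=p_jx+q_jz+r_jt+s_j,\qquad r_j=-\tfrac14p_j^2q_j,\qquad \eta_{jk}=\frac{(p_j-p_k)^2}{(p_j+p_k)^2},\qquad \eta_S=\prod_{j<k,\ j,k\in S}\eta_{jk},$$ $$f_N=\sum_{S\subseteq\{1,\dots,N\}}\eta_S\,e^{\sum_{i\in S}\lambda_i},\qquad g_N=\sum_{S\subseteq\{1,\dots,N\}}(-1)^{|S|}\eta_S\,e^{\sum_{i\in S}\lambda_i},\qquad H_N=4\sum_{n=1}^N\frac1{p_n}\sum_{S\subseteq\{1,\dots,N\}\setminus\{n\}}\eta_S\,e^{\sum_{i\in S}\lambda_i}.$$ Here $\partial_x^{-1}u$ denotes an antiderivative of $u$ with respect to $x$. Put $$w_N=\sigma\Big(\frac{f_N}{g_N}\Big)^2\Big(x+\frac{H_N}{f_N}\Big)+c\Big(\frac{f_N}{g_N}\Big)^2,\qquad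 v_N=\sigma\Big(\log\frac{f_N}{g_N}\Big)_x ,$$ where $(\log F)_x$ means $F_x/F$. Then: 1. Where $f_Ng_N\ne0$, one has $\partial_x\big(x+H_N/f_N\big)=(f_N/g_N)^{-2}$, so that $w_N=\sigma(f_N/g_N)^2\int (f_N/g_N)^{-2}\,dx+c\,(f_N/g_N)^2$ with $x+H_N/f_N$ as the integral. 2. On the open set where $f_Ng_N\ne0$, the functions $v=v_N$ and $v=-v_N=\sigma(\log (g_N/f_N))_x$ are smooth solutions of the modified Calogero–Bogoyavlenskij–Schiff (mCBS) equation $$v_t+\tfrac14v_{xxz}+v^2v_z+\tfrac12v_x\,\partial_x^{-1}(v^2)_z=0$$ for a suitable choice of the antiderivative, the same for both. 3. On the open set $D$ where $f_N$, $g_N$ and $w_N$ are all nonzero, the Miura-type transformation $v=-\frac{1}{2w}(1+\sigma w_x)$ maps $w=w_N$ to $v=-v_N$. 4. On $D$ the function $w=w_N$ is a smooth solution of the $(2+1)$-dimensional Calogero–KdV equation $$w_t+\tfrac14w_{xxz}+\frac{w_z}{4w^2}+\tfrac18w_x\,\partial_x^{-1}\Big(\frac1{w^2}\Big)_z+\frac{w_x^2w_z}{2w^2}-\tfrac18w_x\,\partial_x^{-1}\Big(\frac{w_x^2}{w^2}\Big)_z-\frac{w_xw_{xz}}{2w}-\frac{w_{xx}w_z}{4w}=0$$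 for a suitable choice of the two antiderivatives. If moreover $\operatorname{Re}p_j\ne0$ for all $j$ and the $p_j$ are distinct, then for all $z,t$ the point $(x,z,t)$ belongs to $D$ for all sufficiently negative $x$, and the antiderivatives in 2 and 4 can be chosen so that each tends to $0$ as $x\to-\infty$ for all fixed $z,t$. -/

import Mathlib

open scoped ContDiff Topology

noncomputable section

namespace CKdV

/-- Partial derivative in `x` of a complex valued function of the real variables `x, z, t`. -/
def dx (u : ℝ → ℝ → ℝ → ℂ) : ℝ → ℝ → ℝ → ℂ :=
  fun x z t => deriv (fun x' : ℝ => u x' z t) x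

/-- Partial derivative in `z`. -/
def dz (u : ℝ → ℝ → ℝ → ℂ) : ℝ → ℝ → ℝ → ℂ :=
  fun x z t => deriv (fun z' : ℝ => u x z' t) z

/-- Partial derivative in `t`. -/
def dt (u : ℝ → ℝ → ℝ → ℂ) : ℝ → ℝ → ℝ → ℂ :=
  fun x z t => deriv (fun t' : ℝ => u x z t') t

/-- `u` is smooth (jointly in `x, z, t`) on `D`. -/
def SmoothOn (D : Set (ℝ × ℝ × ℝ)) (u : ℝ → ℝ → ℝ → ℂ) : Prop :=
  ContDiffOn ℝ ∞ (fun y : ℝ × ℝ × ℝ => u y.1 y.2.1 y.2.2) D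

/-- `A` is a realisation of `∂ₓ⁻¹ u` on `D`: an antiderivative of `u` with respect to `x`. -/
def IsXPrimitiveOn (D : Set (ℝ × ℝ × ℝ)) (u A : ℝ → ℝ → ℝ → ℂ) : Prop :=
  ∀ x z t, (x, z, t) ∈ D → HasDerivAt (fun x' : ℝ => A x' z t) (u x z t) x

/-- For all `z, t`, the function `A` tends to `0` as `x → -∞`. -/
def VanishesAtLeft (A : ℝ → ℝ → ℝ → ℂ) : Prop :=
  ∀ z t, Filter.Tendsto (fun x : ℝ => A x z t) Filter.atBot (𝓝 0)

/-- `v` is a smooth solution on the open set `D` of the modified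
Calogero-Bogoyavlenskij-Schiff equation
`v_t + v_xxz / 4 + v² v_z + (1/2) v_x ∂ₓ⁻¹(v²)_z = 0`, with `C` for `∂ₓ⁻¹(v²)_z`. -/
def SolvesMCBS (D : Set (ℝ × ℝ × ℝ)) (v C : ℝ → ℝ → ℝ → ℂ) : Prop :=
  IsOpen D ∧ SmoothOn D v ∧
  IsXPrimitiveOn D (dz fun x z t => v x z t ^ 2) C ∧
  ∀ x z t, (x, z, t) ∈ D →
    dt v x z t + 1 / 4 * dz (dx (dx v)) x z t + v x z t ^ 2 * dz v x z t
      + 1 / 2 * dx v x z t * C x z t = 0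

/-- `w` is a smooth nowhere vanishing solution on the open set `D` of the
(2+1)-dimensional Calogero-KdV equation
`w_t + w_xxz / 4 + w_z / (4 w²) + (1/8) w_x ∂ₓ⁻¹(1/w²)_z + w_x² w_z / (2 w²)
  - (1/8) w_x ∂ₓ⁻¹(w_x²/w²)_z - w_x w_xz / (2 w) - w_xx w_z / (4 w) = 0`,
with `A` for `∂ₓ⁻¹(1/w²)_z` and `B` for `∂ₓ⁻¹(w_x²/w²)_z`. -/
def SolvesCKdV (D : Set (ℝ × ℝ × ℝ)) (w A B : ℝ → ℝ → ℝ → ℂ) : Prop :=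
  IsOpen D ∧ SmoothOn D w ∧ (∀ x z t, (x, z, t) ∈ D → w x z t ≠ 0) ∧
  IsXPrimitiveOn D (dz fun x z t => 1 / w x z t ^ 2) A ∧
  IsXPrimitiveOn D (dz fun x z t => dx w x z t ^ 2 / w x z t ^ 2) B ∧
  ∀ x z t, (x, z, t) ∈ D →
    dt w x z t + 1 / 4 * dz (dx (dx w)) x z t + dz w x z t / (4 * w x z t ^ 2)
      + 1 / 8 * dx w x z t * A x z t
      + dx w x z t ^ 2 * dz w x z t / (2 * w x z t ^ 2)
      - 1 / 8 * dx w x z t * B x z t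
      - dx w x z t * dz (dx w) x z t / (2 * w x z t)
      - dx (dx w) x z t * dz w x z t / (4 * w x z t) = 0

/-- The Miura type transformation `w ↦ -(1 + σ w_x) / (2 w)`. -/
def miura (σ : ℂ) (w : ℝ → ℝ → ℝ → ℂ) : ℝ → ℝ → ℝ → ℂ :=
  fun x z t => -(1 / (2 * w x z t)) * (1 + σ * dx w x z t)

variable {N : ℕ}

/-- `λ_j = p_j x + q_j z + r_j t + s_j` with `r_j = -p_j² q_j / 4`. -/
def lam (p q s : Fin N → ℂ) (j : Fin N) (x z t : ℝ) : ℂ :=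
  p j * x + q j * z + (-(1 / 4) * p j ^ 2 * q j) * t + s j

/-- `η_{jk} = (p_j - p_k)² / (p_j + p_k)²`. -/
def eta (p : Fin N → ℂ) (j k : Fin N) : ℂ :=
  (p j - p k) ^ 2 / (p j + p k) ^ 2

/-- `η_S`, the product of all `η_{jk}` with `j < k` in `S` (equal to `1` when `S` has at most
one element). -/
def etaProd (p : Fin N → ℂ) (S : Finset (Fin N)) : ℂ :=
  ∏ j ∈ S, ∏ k ∈ S with j < k, eta p j k

/-- The sum over all subsets `S` of `T` of `η_S exp (∑_{i ∈ S} λ_i)`; the empty set gives the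
term `1`. -/
def fSub (p q s : Fin N → ℂ) (T : Finset (Fin N)) (x z t : ℝ) : ℂ :=
  ∑ S ∈ T.powerset, etaProd p S * Complex.exp (∑ i ∈ S, lam p q s i x z t)

/-- `f_N`. -/
def f (p q s : Fin N → ℂ) (x z t : ℝ) : ℂ := fSub p q s Finset.univ x z t

/-- `g_N`. -/
def g (p q s : Fin N → ℂ) (x z t : ℝ) : ℂ :=
  ∑ S : Finset (Fin N),
    (-1) ^ S.card * etaProd p S * Complex.exp (∑ i ∈ S, lam p q s i x z t)

/-- `H_N = 4 ∑_n f_{N-1}(n̂) / p_n`, where in `f_{N-1}(n̂)` the index `n` is left out. -/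
def H (p q s : Fin N → ℂ) (x z t : ℝ) : ℂ :=
  4 * ∑ n : Fin N, fSub p q s (Finset.univ.erase n) x z t / p n

/-- `x + H_N / f_N`, which stands for `∫ (f_N / g_N)⁻² dx`. -/
def Phi (p q s : Fin N → ℂ) (x z t : ℝ) : ℂ :=
  x + H p q s x z t / f p q s x z t

/-- `v_N = σ (log (f_N / g_N))_x`, the logarithmic derivative being `(f_N/g_N)_x / (f_N/g_N)`. -/
def vSol (σ : ℂ) (p q s : Fin N → ℂ) (x z t : ℝ) : ℂ :=
  σ * logDeriv (fun x' : ℝ => f p q s x' z t / g p q s x' z t) x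

/-- `w_N = σ (f_N/g_N)² ∫ (f_N/g_N)⁻² dx + c (f_N/g_N)²`. -/
def wSol (σ c : ℂ) (p q s : Fin N → ℂ) (x z t : ℝ) : ℂ :=
  σ * (f p q s x z t / g p q s x z t) ^ 2 * Phi p q s x z t
    + c * (f p q s x z t / g p q s x z t) ^ 2

/-- The points at which neither `f_N` nor `g_N` vanishes. -/
def domV (p q s : Fin N → ℂ) : Set (ℝ × ℝ × ℝ) :=
  {y | f p q s y.1 y.2.1 y.2.2 ≠ 0 ∧ g p q s y.1 y.2.1 y.2.2 ≠ 0}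

/-- The points at which none of `f_N`, `g_N`, `w_N` vanishes. -/
def domW (σ c : ℂ) (p q s : Fin N → ℂ) : Set (ℝ × ℝ × ℝ) :=
  {y | y ∈ domV p q s ∧ wSol σ c p q s y.1 y.2.1 y.2.2 ≠ 0}

end CKdV

end

noncomputable section

namespace CKdV

open Matrix

variable {N : ℕ}

/-! ### Determinants -/

/-! The solution consists of determinants. Let A_jk = 2 c_j c_k / (p_j + p_k) with c_j² = p_j exp
λ_j, P = diag p, Q = diag q, X = (1 + A)⁻¹, Y = (1 - A)⁻¹. Cauchy's determinant
(`det_cauchy_submatrix`) gives f = det (1 + A), g = det (1 - A) and H/f = 4 tr P⁻¹X. The engine is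
the Sylvester equation PA + AP = 2K with K = c cᵀ of rank one. Logarithmic derivatives become traces
of words in K, X, Y, P, Q; rank one merges a product of traces into one trace, and Sylvester's
equation removes a K from a word.

Write u = (log (f/g))_x = tr KX + tr KY and Φ = x + H/f. Four trace identities carry the theorem:
`miura_identity`, (log fg)_xx = -u²; `flow_identity`, 4 (log (f/g))_t + u_xz + 2u (log fg)_xz = 0;
`square_identity`, Φ_x = (g/f)²; `flow_potential_identity`, Φ_t = -(g/f)² (log g)_xz.

The x-derivative of the second, combined with the first, is mCBS for ±σu with antiderivative C =
(log fg)_xz (`FlowData.solvesMCBS`). The third gives the Riccati equation w_x = 2uw + σ, which is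
the Miura relation, and the fourth gives w_t. Substituting these yields Calogero-KdV
(`FlowData.solvesCKdV`); only the difference of the two antiderivatives enters, and it can be taken
to be 4C + 2σ (1/w)_z.

As x → -∞ the exponential over {j : Re p_j < 0} dominates f, g and H. Hence f/g → ±1, w ~ σx and w_z
→ 0, so (1/w²)_z is integrable at -∞ and the antiderivatives can be normalised there. -/

theorem det_one_add_eq_sum_minors {n : Type*} [Fintype n] [DecidableEq n]
    (M : Matrix n n ℂ) :
    (1 + M).det = ∑ S : Finset n,
      (M.submatrix (Subtype.val : S → n) (Subtype.val : S → n)).det := by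
  rw [add_comm]
  -- Multilinearity in the rows: each row is taken from M (index in S) or from the identity.
  have h := (detRowAlternating : (n → ℂ) [⋀^n]→ₗ[ℂ] ℂ).map_add_univ
    (fun i => M i) (fun i => (1 : Matrix n n ℂ) i)
  refine Eq.trans h (Finset.sum_congr rfl fun S _ => ?_)
  exact det_piecewise_one_eq_submatrix_det M S

/-- A square root of `p_j`, times `exp (l_j / 2)`. -/
def cvec (p l : Fin N → ℂ) (j : Fin N) : ℂ := Complex.exp ((Complex.log (p j) + l j) / 2)

/-- The Cauchy type matrix whose principal minors are the `η_S exp (∑_{i ∈ S} l_i)`. -/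
def cauchy (p l : Fin N → ℂ) : Matrix (Fin N) (Fin N) ℂ :=
  fun j k => 2 * cvec p l j * cvec p l k / (p j + p k)

theorem cvec_sq {p : Fin N → ℂ} (hp : ∀ j, p j ≠ 0) (l : Fin N → ℂ) (j : Fin N) :
    cvec p l j ^ 2 = p j * Complex.exp (l j) := by
  rw [cvec, ← Complex.exp_nat_mul]
  rw [show ((2 : ℕ) : ℂ) * ((Complex.log (p j) + l j) / 2) = Complex.log (p j) + l j by
    push_cast; ring, Complex.exp_add, Complex.exp_log (hp j)]

theorem add_ne_zero_of_pairwise {p : Fin N → ℂ} (hp : ∀ j, p j ≠ 0)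
    (hpp : ∀ j k, j ≠ k → p j + p k ≠ 0) (j k : Fin N) : p j + p k ≠ 0 := by
  rcases eq_or_ne j k with rfl | h
  · rw [← two_mul]; exact mul_ne_zero two_ne_zero (hp j)
  · exact hpp j k h

theorem etaProd_insert_max (p : Fin N → ℂ) {S : Finset (Fin N)} {m : Fin N}
    (hm : ∀ j ∈ S, j < m) :
    etaProd p (insert m S) = (∏ j ∈ S, eta p j m) * etaProd p S := by
  have hmS : m ∉ S := fun h => lt_irrefl _ (hm m h)
  unfold etaProd
  rw [Finset.prod_insert hmS]
  have h1 : (insert m S).filter (fun k => m < k) = ∅ := by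
    ext k
    simp only [Finset.mem_filter, Finset.mem_insert, Finset.notMem_empty, iff_false, not_and,
      not_lt]
    rintro (rfl | h)
    · exact le_rfl
    · exact (hm k h).le
  rw [h1, Finset.prod_empty, one_mul, ← Finset.prod_mul_distrib]
  refine Finset.prod_congr rfl fun j hj => ?_
  have h2 : (insert m S).filter (fun k => j < k) = insert m (S.filter (fun k => j < k)) := by
    rw [Finset.filter_insert, if_pos (hm j hj)]
  rw [h2, Finset.prod_insert (fun h => hmS (Finset.mem_filter.1 h).1)]

/-- Cauchy's determinant for the principal minors of `cauchy`. -/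
theorem det_cauchy_submatrix {p : Fin N → ℂ} (hp : ∀ j, p j ≠ 0)
    (hpp : ∀ j k, j ≠ k → p j + p k ≠ 0) (l : Fin N → ℂ) (S : Finset (Fin N)) :
    ((cauchy p l).submatrix (Subtype.val : S → Fin N) (Subtype.val : S → Fin N)).det
      = etaProd p S * Complex.exp (∑ i ∈ S, l i) := by
  induction S using Finset.induction_on_max with
  | empty => simp [etaProd]
  | insert m S hm ih =>
    have hmS : m ∉ S := fun h => lt_irrefl _ (hm m h)
    have hne := add_ne_zero_of_pairwise hp hpp
    set C := cauchy p l
    let e : {i // i ∈ insert m S} ≃ Option {i // i ∈ S} :=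
      Finset.subtypeInsertEquivOption hmS
    let e' : S ⊕ Unit ≃ {i // i ∈ insert m S} :=
      (Equiv.optionEquivSumPUnit.{0} {i // i ∈ S}).symm.trans e.symm
    have e'l : ∀ i : S, ((e' (Sum.inl i)) : Fin N) = i := fun i => rfl
    have e'r : ((e' (Sum.inr ())) : Fin N) = m := rfl
    have hc : C m m = Complex.exp (l m) := by
      have h1 : C m m = 2 * cvec p l m * cvec p l m / (p m + p m) := rfl
      rw [h1, mul_assoc, ← sq, cvec_sq hp]
      field_simp [hp m]
      ring
    set d := Complex.exp (l m) with hd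
    have hd0 : d ≠ 0 := Complex.exp_ne_zero _
    have hcd : cvec p l m * cvec p l m = p m * d := by rw [← sq, cvec_sq hp]
    let b : Matrix S Unit ℂ := of fun i _ => C i m
    let r : Matrix Unit S ℂ := of fun _ k => C m k / d
    let M : Matrix S S ℂ := C.submatrix Subtype.val Subtype.val
    -- With m placed last, the pivot exp (l m) is factored out of the last row. The remaining matrix
    -- has corner 1, so its determinant is that of the Schur complement.
    have hblock : (C.submatrix (Subtype.val : ↥(insert m S) → Fin N) Subtype.val).submatrix e' e'
        = fromBlocks 1 0 0 (d • 1) * fromBlocks M b r 1 := by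
      rw [fromBlocks_multiply]
      ext (i | i) (k | k)
      · simp [e'l, M]
      · simp [e'l, e'r, b]
      · simp [e'l, e'r, r, hd0, mul_div_cancel₀]
      · simp [e'r, hc]
    let D : Matrix S S ℂ := diagonal fun i => (p i - p m) / (p i + p m)
    -- The Schur complement of a Cauchy matrix is the smaller Cauchy matrix with rows and columns
    -- rescaled, because (p_i + p_m)(p_k + p_m) - 2 p_m (p_i + p_k) = (p_i - p_m)(p_k - p_m). The
    -- two copies of D produce the squares in η.
    have hschur : M - b * r = D * M * D := by
      ext i k
      have e1 : M i k = 2 * cvec p l i * cvec p l k / (p i + p k) := rfl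
      have e2 : C i m = 2 * cvec p l i * cvec p l m / (p i + p m) := rfl
      have e3 : C m k = 2 * cvec p l m * cvec p l k / (p m + p k) := rfl
      have e4 : C i m * (C m k / d)
          = 4 * cvec p l i * cvec p l k * p m / ((p i + p m) * (p k + p m)) := by
        rw [e2, e3, add_comm (p m) (p k)]
        have h1 := hne i m
        have h2 := hne k m
        field_simp
        linear_combination (4 * cvec p l i * cvec p l k) * hcd
      simp only [D, diagonal_mul, mul_diagonal, Matrix.sub_apply]
      rw [mul_apply, Fintype.sum_unique]
      simp only [b, r, of_apply]
      rw [e4, e1]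
      have h1 := hne i m
      have h2 := hne k m
      have h3 := hne i k
      field_simp
      ring
    rw [← det_submatrix_equiv_self e', hblock, det_mul, det_fromBlocks_zero₁₂,
      det_fromBlocks_one₂₂, hschur, det_mul, det_mul, ih, etaProd_insert_max p hm,
      Finset.sum_insert hmS, Complex.exp_add, det_diagonal]
    have h4 : ∏ j ∈ S, eta p j m
        = (∏ i : S, (p i - p m) / (p i + p m)) * (∏ i : S, (p i - p m) / (p i + p m)) := by
      rw [← Finset.prod_mul_distrib, ← Finset.prod_coe_sort S]
      refine Finset.prod_congr rfl fun i _ => ?_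
      rw [eta, ← div_pow, sq]
    rw [h4]
    simp only [det_one, det_unique, Matrix.smul_apply, one_apply_eq, smul_eq_mul]
    ring

/-- `det (1 + ε A)` as a sum of exponentials. -/
theorem det_one_add_smul_cauchy {p : Fin N → ℂ} (hp : ∀ j, p j ≠ 0)
    (hpp : ∀ j k, j ≠ k → p j + p k ≠ 0) (ε : ℂ) (l : Fin N → ℂ) :
    (1 + ε • cauchy p l).det
      = ∑ S : Finset (Fin N), ε ^ S.card * etaProd p S * Complex.exp (∑ i ∈ S, l i) := by
  rw [det_one_add_eq_sum_minors]
  refine Finset.sum_congr rfl fun S _ => ?_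
  rw [show ((ε • cauchy p l).submatrix (Subtype.val : S → Fin N) (Subtype.val : S → Fin N))
    = ε • (cauchy p l).submatrix Subtype.val Subtype.val from rfl, det_smul, det_cauchy_submatrix hp hpp, Fintype.card_coe,
    mul_assoc]

/-- The diagonal entries of the adjugate of `1 + M` are the sums of the principal minors that avoid
the given index. -/
theorem adjugate_one_add_apply_self {n : Type*} [Fintype n] [DecidableEq n]
    (M : Matrix n n ℂ) (i : n) :
    (1 + M).adjugate i i = ∑ S ∈ (Finset.univ.erase i).powerset,
      (M.submatrix (Subtype.val : S → n) (Subtype.val : S → n)).det := by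
  -- Putting e_i into row i of 1 + M zeroes row i of M; this kills the principal minors through i
  -- and leaves the others unchanged.
  have h1 : (1 + M).updateRow i (Pi.single i 1) = 1 + M.updateRow i 0 := by
    ext j k
    rcases eq_or_ne j i with rfl | h
    · simp [one_apply, Pi.single_apply, eq_comm]
    · simp [h]
  rw [adjugate_apply, h1, det_one_add_eq_sum_minors]
  symm
  refine Finset.sum_subset_zero_on_sdiff (Finset.subset_univ _) (fun S hS => ?_) (fun S hS => ?_)
  · have hi : i ∈ S := by
      by_contra hi
      refine (Finset.mem_sdiff.1 hS).2 (Finset.mem_powerset.2 fun j hj => ?_)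
      exact Finset.mem_erase.2 ⟨fun h => hi (h ▸ hj), Finset.mem_univ _⟩
    refine det_eq_zero_of_row_eq_zero ⟨i, hi⟩ fun j => ?_
    simp
  · congr 1
    ext j k
    have hj : (j : n) ≠ i := (Finset.mem_erase.1 (Finset.mem_powerset.1 hS j.2)).1
    simp [hj]

/-- Adjugate over determinant is the resolvent, so this is what turns H/f into 4 tr P⁻¹X in
`Phi_eq`. -/
theorem fSub_erase_eq_adjugate {p : Fin N → ℂ} (hp : ∀ j, p j ≠ 0)
    (hpp : ∀ j k, j ≠ k → p j + p k ≠ 0) (q s : Fin N → ℂ) (n : Fin N) (x z t : ℝ) :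
    fSub p q s (Finset.univ.erase n) x z t
      = (1 + cauchy p (fun j => lam p q s j x z t)).adjugate n n := by
  rw [adjugate_one_add_apply_self]
  exact Finset.sum_congr rfl fun S _ => (det_cauchy_submatrix hp hpp _ S).symm

end CKdV
end

noncomputable section

namespace CKdV

open Matrix

/-! ### Trace identities -/

section Identities

variable {n : Type*} [Fintype n]

theorem trace_vecMulVec_mul (c : n → ℂ) (M : Matrix n n ℂ) :
    (vecMulVec c c * M).trace = c ⬝ᵥ M *ᵥ c := by
  rw [vecMulVec_mul, trace_vecMulVec, dotProduct_comm, ← dotProduct_mulVec]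

theorem vecMulVec_mul_mul (c : n → ℂ) (M : Matrix n n ℂ) :
    vecMulVec c c * M * vecMulVec c c = (vecMulVec c c * M).trace • vecMulVec c c := by
  rw [trace_vecMulVec_mul, vecMulVec_mul, vecMulVec_mul_vecMulVec, ← dotProduct_mulVec,
    vecMulVec_smul]

variable [DecidableEq n] {A K P Q X Y : Matrix n n ℂ}

/-- The algebraic relations between the matrices `A`, `X = (1 + A)⁻¹`, `Y = (1 - A)⁻¹`, `P`, `Q` and
the matrix `K` of rank one. -/
structure Relations (A K P Q X Y : Matrix n n ℂ) : Prop where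
  sylvester : P * A + A * P = 2 * K
  rankOne : ∀ M, K * M * K = (K * M).trace • K
  mul_left : A * X = 1 - X
  mul_right : X * A = 1 - X
  mul_left' : A * Y = Y - 1
  mul_right' : Y * A = Y - 1
  comm : P * Q = Q * P

namespace Relations

variable (h : Relations A K P Q X Y)

include h

/-- Rank one at work: nonlinear terms in traces become linear in longer words. -/
theorem trace_mul_trace (M M' : Matrix n n ℂ) :
    (K * M).trace * (K * M').trace = (K * M * K * M').trace := by
  rw [h.rankOne, smul_mul, trace_smul, smul_eq_mul]

/-- The reduction rule for words. A K between two resolvents is traded for P, and the A that appears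
is absorbed by its neighbour through AX = 1 - X or AY = Y - 1. The next four lemmas are its
instances. -/
theorem two_K (M M' : Matrix n n ℂ) :
    M * K * M' + M * K * M' = M * P * (A * M') + (M * A) * P * M' := by
  have : M * K * M' + M * K * M' = M * (2 * K) * M' := by noncomm_ring
  rw [this, ← h.sylvester]
  noncomm_ring

theorem X_K_X : X * K * X + X * K * X = X * P + P * X - X * P * X - X * P * X := by
  rw [h.two_K, h.mul_left, h.mul_right]; noncomm_ring

theorem Y_K_Y : Y * K * Y + Y * K * Y = Y * P * Y + Y * P * Y - Y * P - P * Y := by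
  rw [h.two_K, h.mul_left', h.mul_right']; noncomm_ring

theorem X_K_Y : X * K * Y + X * K * Y = P * Y - X * P := by
  rw [h.two_K, h.mul_left', h.mul_right]; noncomm_ring

theorem Y_K_X : Y * K * X + Y * K * X = Y * P - P * X := by
  rw [h.two_K, h.mul_left, h.mul_right']; noncomm_ring

/-- The bilinear equation `D_x² f·g = 0` in terms of traces. -/
theorem miura_identity :
    (K * X * P * X).trace - (K * Y * P * Y).trace + ((K * X).trace + (K * Y).trace) ^ 2 = 0 := by
  have e1 := h.trace_mul_trace X X
  have e2 := h.trace_mul_trace X Y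
  have e3 := h.trace_mul_trace Y X
  have e4 := h.trace_mul_trace Y Y
  -- Expanding the square gives the words KMKM' with M, M' among X, Y. After reduction the short
  -- terms such as tr KXP cancel over the four words; only tr KXPX and tr KYPY survive.
  have f1 := congrArg (fun M => (K * M).trace) h.X_K_X
  have f2 := congrArg (fun M => (K * M).trace) h.X_K_Y
  have f3 := congrArg (fun M => (K * M).trace) h.Y_K_X
  have f4 := congrArg (fun M => (K * M).trace) h.Y_K_Y
  simp only [mul_add, mul_sub, trace_add, trace_sub, ← mul_assoc] at f1 f2 f3 f4 e1 e2 e3 e4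
  linear_combination e1 + e2 + e3 + e4 + (f1 + f2 + f3 + f4) / 2

/-- The equation of motion in terms of traces. -/
theorem flow_identity :
    (P * P * Q * X).trace - (P * P * Q * Y).trace
      + ((K * X * P * X * Q * X).trace + (K * X * Q * X * P * X).trace - (K * X * P * Q * X).trace)
      + ((K * Y * P * Y * Q * Y).trace + (K * Y * Q * Y * P * Y).trace - (K * Y * P * Q * Y).trace)
      + 2 * ((K * X).trace + (K * Y).trace)
        * ((K * X * Q * X).trace - (K * Y * Q * Y).trace) = 0 := by
  have hc : ∀ M, M * Q * P = M * P * Q := fun M => by rw [mul_assoc, ← h.comm, ← mul_assoc]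
  have hc' : Q * P = P * Q := h.comm.symm
  have e1 := h.trace_mul_trace X (X * Q * X)
  have e2 := h.trace_mul_trace (X * Q * X) X
  have e3 := h.trace_mul_trace Y (Y * Q * Y)
  have e4 := h.trace_mul_trace (Y * Q * Y) Y
  have e5 := h.trace_mul_trace X (Y * Q * Y)
  have e6 := h.trace_mul_trace (Y * Q * Y) X
  have e7 := h.trace_mul_trace Y (X * Q * X)
  have e8 := h.trace_mul_trace (X * Q * X) Y
  have f1 := congrArg (fun M => (K * M * Q * X).trace) h.X_K_X
  have f2 := congrArg (fun M => (K * X * Q * M).trace) h.X_K_X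
  have f3 := congrArg (fun M => (K * M * Q * Y).trace) h.Y_K_Y
  have f4 := congrArg (fun M => (K * Y * Q * M).trace) h.Y_K_Y
  have f5 := congrArg (fun M => (K * M * Q * Y).trace) h.X_K_Y
  have f6 := congrArg (fun M => (K * Y * Q * M).trace) h.Y_K_X
  have f7 := congrArg (fun M => (K * M * Q * X).trace) h.Y_K_X
  have f8 := congrArg (fun M => (K * X * Q * M).trace) h.X_K_Y
  -- The words left that mix X and Y are KXPQY and KYPQX. Rotated cyclically they contain YKX and
  -- XKY, and a second reduction turns them into traces of P²QX and P²QY.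
  have f9 := congrArg (fun M => (P * Q * M).trace) h.Y_K_X
  have f10 := congrArg (fun M => (P * Q * M).trace) h.X_K_Y
  have c1 : (K * X * P * Q * Y).trace = (P * Q * Y * K * X).trace := by
    rw [show K * X * P * Q * Y = (K * X) * (P * Q * Y) by noncomm_ring, trace_mul_comm]
    simp only [← mul_assoc]
  have c2 : (K * Y * P * Q * X).trace = (P * Q * X * K * Y).trace := by
    rw [show K * Y * P * Q * X = (K * Y) * (P * Q * X) by noncomm_ring, trace_mul_comm]
    simp only [← mul_assoc]
  have c3 : (P * Q * X * P).trace = (P * P * Q * X).trace := by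
    rw [trace_mul_comm]
    simp only [← mul_assoc]
  have c4 : (P * Q * Y * P).trace = (P * P * Q * Y).trace := by
    rw [trace_mul_comm]
    simp only [← mul_assoc]
  have c5 : P * Q * P = P * P * Q := by rw [hc]
  simp only [mul_add, mul_sub, add_mul, sub_mul, trace_add, trace_sub, ← mul_assoc, hc, hc'] at *
  linear_combination e1 + e2 - e3 - e4 - e5 - e6 + e7 + e8
    + (f1 + f2 - f3 - f4 - f5 - f6 + f7 + f8) / 2 + c1 + c2 + (f9 + f10 - c3 + c4) / 2

variable {P' : Matrix n n ℂ} (hP : P * P' = 1) (hP' : P' * P = 1)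

include hP hP'

/-- The Sylvester equation multiplied by P⁻¹ on both sides: the reduction rule for words from the
potential Φ, which contain P⁻¹. -/
theorem P'_K_P' : P' * K * P' + P' * K * P' = A * P' + P' * A := by
  have : P' * K * P' + P' * K * P' = P' * (2 * K) * P' := by noncomm_ring
  rw [this, ← h.sylvester, mul_add, add_mul, ← mul_assoc, hP', one_mul, mul_assoc, mul_assoc, hP,
    mul_one]

/-- The equation `f² + D_x H·f = g²` in terms of traces. -/
theorem square_identity (ht : (K * X * P').trace = (P' * X * K).trace) :
    (1 - 2 * (P' * X * K).trace) ^ 2 = 1 - 4 * (P' * X * K * X).trace := by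
  -- Ordering the two factors of k² this way puts K between two copies of P⁻¹, where `P'_K_P'`
  -- applies.
  have e1 := h.trace_mul_trace (X * P') (P' * X)
  have f1 := congrArg (fun M => (K * X * M * X).trace) (h.P'_K_P' hP hP')
  have c1 : (K * P' * X).trace = (P' * X * K).trace := by
    rw [mul_assoc, trace_mul_comm]
  have c2 : (K * X * P' * X).trace = (P' * X * K * X).trace := by
    rw [show K * X * P' * X = (K * X) * (P' * X) by noncomm_ring, trace_mul_comm]
    simp only [← mul_assoc]
  have r1 : K * X * A * P' * X = K * P' * X - K * X * P' * X := by
    rw [mul_assoc K X A, h.mul_right]; noncomm_ring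
  have r2 : K * X * P' * A * X = K * X * P' - K * X * P' * X := by
    rw [mul_assoc (K * X * P') A X, h.mul_left]; noncomm_ring
  simp only [mul_add, add_mul, trace_add, trace_sub, ← mul_assoc, r1, r2] at e1 f1
  rw [ht] at e1 f1
  rw [c1] at e1 f1
  linear_combination 4 * e1 + 2 * f1 - 4 * c2

/-- The equation `D_t H·f + D_x D_z g·g / 2 = 0` in terms of traces. -/
theorem flow_potential_identity (ht : (K * X * P').trace = (P' * X * K).trace) :
    (1 - 2 * (P' * X * K).trace) ^ 2 * (K * Y * Q * Y).trace
      = ((P' * X * (P * P * Q)).trace + (P' * (P * P * Q) * X).trace) / 2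
        - (P' * X * (P * P * Q) * X).trace := by
  set k := (P' * X * K).trace with hk
  have c0 : (K * P' * X).trace = k := by
    rw [mul_assoc, trace_mul_comm]
  -- `(1 - 2k) Y K = P X P' K` and `(1 - 2k) K Y = K P' X P`
  have y1 : (1 - 2 * k) • (Y * K) = P * X * P' * K := by
    have a1 := congrArg (fun M => M * P' * K) h.Y_K_X
    have a2 := h.rankOne (X * P')
    have a3 : Y * K * X * P' * K = k • (Y * K) := by
      rw [show Y * K * X * P' * K = Y * (K * (X * P') * K) by noncomm_ring, a2, mul_smul_comm,
        ← mul_assoc, ht]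
    have a4 : Y * P * P' * K = Y * K := by rw [mul_assoc Y P P', hP, mul_one]
    simp only [add_mul, sub_mul, a3, a4] at a1
    rw [sub_smul, one_smul, two_mul, add_smul, a1]
    abel
  have y2 : (1 - 2 * k) • (K * Y) = K * P' * X * P := by
    have a1 := congrArg (fun M => K * P' * M) h.X_K_Y
    have a2 := h.rankOne (P' * X)
    have a3 : K * P' * X * K * Y = k • (K * Y) := by
      rw [show K * P' * X * K * Y = (K * (P' * X) * K) * Y by noncomm_ring, a2, smul_mul,
        ← mul_assoc, c0]
    have a4 : K * P' * P * Y = K * Y := by rw [mul_assoc K P' P, hP', mul_one]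
    simp only [mul_add, mul_sub, ← mul_assoc, a3, a4] at a1
    rw [sub_smul, one_smul, two_mul, add_smul, a1]
    abel
  -- One factor 1 - 2k on each side of K converts the adjacent Y into words in X, so the claim
  -- becomes an identity in X alone.
  have y3 : (1 - 2 * k) ^ 2 • (Y * K * Y) = P * X * (P' * K * P') * X * P := by
    rw [sq, mul_smul, ← smul_mul, y1, mul_assoc _ K Y, ← mul_smul_comm, y2]
    simp only [← mul_assoc]
  have y4 : (1 - 2 * k) ^ 2 * (K * Y * Q * Y).trace
      = (Q * (P * X * (P' * K * P') * X * P)).trace := by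
    rw [← y3, mul_smul_comm, trace_smul, smul_eq_mul]
    congr 1
    rw [show K * Y * Q * Y = (K * Y) * (Q * Y) by noncomm_ring, trace_mul_comm]
    simp only [← mul_assoc]
  have f1 := congrArg (fun M => (Q * P * X * M * X * P).trace) (h.P'_K_P' hP hP')
  have r1 : Q * P * X * A * P' * X * P = Q * X * P - Q * P * X * P' * X * P := by
    rw [mul_assoc (Q * P) X A, h.mul_right]
    rw [show Q * P * (1 - X) * P' * X * P = Q * (P * P') * X * P - Q * P * X * P' * X * P by
      noncomm_ring, hP, mul_one]
  have r2 : Q * P * X * P' * A * X * P = Q * P * X - Q * P * X * P' * X * P := by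
    rw [mul_assoc (Q * P * X * P') A X, h.mul_left]
    rw [show Q * P * X * P' * (1 - X) * P = Q * P * X * (P' * P) - Q * P * X * P' * X * P by
      noncomm_ring, hP', mul_one]
  simp only [mul_add, add_mul, trace_add, trace_sub, ← mul_assoc, r1, r2] at f1 y4 ⊢
  have c1 : (P' * X * P * P * Q * X).trace = (Q * P * X * P' * X * P).trace := by
    rw [show P' * X * P * P * Q * X = (P' * X * P) * (P * Q * X) by noncomm_ring, trace_mul_comm,
      h.comm]
    simp only [← mul_assoc]
  have c2 : (P' * P * P * Q * X).trace = (Q * P * X).trace := by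
    rw [hP', one_mul, h.comm]
  have c3 : (P' * X * P * P * Q).trace = (Q * X * P).trace := by
    rw [show P' * X * P * P * Q = (P' * X * P) * (P * Q) by noncomm_ring, trace_mul_comm, h.comm]
    rw [show Q * P * (P' * X * P) = Q * (P * P') * X * P by noncomm_ring, hP, mul_one]
  rw [c1, c2, c3]
  linear_combination y4 + f1 / 2

end Relations

end Identities
end CKdV
end

noncomputable section

namespace CKdV

open Matrix

/-! ### Matrix valued functions of a real variable -/

section Calculus

variable {n : Type*}

/-- Entrywise differentiability of a matrix valued function. -/
def EntryDeriv (F : ℝ → Matrix n n ℂ) (F' : Matrix n n ℂ) (τ : ℝ) : Prop :=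
  ∀ i j, HasDerivAt (fun τ => F τ i j) (F' i j) τ

namespace EntryDeriv

variable {F G : ℝ → Matrix n n ℂ} {F' G' : Matrix n n ℂ} {τ : ℝ}

theorem const (M : Matrix n n ℂ) (τ : ℝ) : EntryDeriv (fun _ => M) 0 τ :=
  fun _ _ => hasDerivAt_const _ _

theorem add (hF : EntryDeriv F F' τ) (hG : EntryDeriv G G' τ) :
    EntryDeriv (fun τ => F τ + G τ) (F' + G') τ :=
  fun i j => (hF i j).add (hG i j)

theorem const_smul (hF : EntryDeriv F F' τ) (a : ℂ) :
    EntryDeriv (fun τ => a • F τ) (a • F') τ :=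
  fun i j => (hF i j).const_mul a

theorem congr_deriv (hF : EntryDeriv F F' τ) (h : F' = G') : EntryDeriv F G' τ := h ▸ hF

theorem unique (hF : EntryDeriv F F' τ) (hG : EntryDeriv G G' τ) (h : F =ᶠ[𝓝 τ] G) : F' = G' := by
  ext i j
  have h' : (fun τ => F τ i j) =ᶠ[𝓝 τ] fun τ => G τ i j := h.mono fun τ e => by simp only [e]
  exact (hF i j).unique ((hG i j).congr_of_eventuallyEq h')

variable [Fintype n]

theorem mul (hF : EntryDeriv F F' τ) (hG : EntryDeriv G G' τ) :
    EntryDeriv (fun τ => F τ * G τ) (F' * G τ + F τ * G') τ := by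
  intro i j
  have := HasDerivAt.fun_sum (u := Finset.univ) fun k _ => (hF i k).fun_mul (hG k j)
  simpa only [mul_apply, Matrix.add_apply, ← Finset.sum_add_distrib] using this

theorem mul_const (hF : EntryDeriv F F' τ) (M : Matrix n n ℂ) :
    EntryDeriv (fun τ => F τ * M) (F' * M) τ := by
  simpa using hF.mul (const M τ)

theorem const_mul (M : Matrix n n ℂ) (hF : EntryDeriv F F' τ) :
    EntryDeriv (fun τ => M * F τ) (M * F') τ := by
  simpa using (const M τ).mul hF

theorem trace (hF : EntryDeriv F F' τ) :
    HasDerivAt (fun τ => (F τ).trace) F'.trace τ :=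
  HasDerivAt.fun_sum fun i _ => hF i i

variable [DecidableEq n]

/-- Jacobi's formula. -/
theorem det_adjugate (hF : EntryDeriv F F' τ) :
    HasDerivAt (fun τ => (F τ).det) ((F τ).adjugate * F').trace τ := by
  have h1 : HasDerivAt (fun τ => (F τ).det)
      (∑ σ : Equiv.Perm n, ((Equiv.Perm.sign σ : ℤ) : ℂ) *
        ∑ i, (∏ j ∈ Finset.univ.erase i, F τ (σ j) j) • F' (σ i) i) τ := by
    simp only [det_apply']
    exact HasDerivAt.fun_sum fun σ _ =>
      (HasDerivAt.fun_finsetProd fun i _ => hF (σ i) i).const_mul _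
  convert h1 using 1
  have h2 : ∀ i, ((F τ).adjugate * F') i i = ((F τ).updateCol i fun k => F' k i).det := by
    intro i
    rw [← cramer_apply, cramer_eq_adjugate_mulVec]
    rfl
  simp only [Matrix.trace, diag_apply, h2, det_apply']
  rw [Finset.sum_comm]
  refine Finset.sum_congr rfl fun σ _ => ?_
  rw [Finset.mul_sum]
  refine Finset.sum_congr rfl fun i _ => ?_
  congr 1
  rw [← Finset.mul_prod_erase _ _ (Finset.mem_univ i), updateCol_self, smul_eq_mul, mul_comm]
  congr 1
  refine Finset.prod_congr rfl fun j hj => ?_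
  rw [updateCol_ne (Finset.ne_of_mem_erase hj)]

theorem det (hF : EntryDeriv F F' τ) (h0 : (F τ).det ≠ 0) :
    HasDerivAt (fun τ => (F τ).det) ((F τ).det * ((F τ)⁻¹ * F').trace) τ := by
  convert hF.det_adjugate using 1
  rw [inv_def, Ring.inverse_eq_inv', smul_mul, trace_smul, smul_eq_mul, mul_inv_cancel_left₀ h0]

/-- Entries of the adjugate are determinants, so the inverse is differentiable by Jacobi's formula;
its derivative is then found by differentiating F⁻¹F = 1 near τ. -/
theorem inv (hF : EntryDeriv F F' τ) (h0 : (F τ).det ≠ 0) :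
    EntryDeriv (fun τ => (F τ)⁻¹) (-((F τ)⁻¹ * F' * (F τ)⁻¹)) τ := by
  have hdet := hF.det h0
  have hadj : ∀ i j, ∃ d, HasDerivAt (fun τ => (F τ).adjugate i j) d τ := by
    intro i j
    have : EntryDeriv (fun τ => (F τ).updateRow j (Pi.single i 1)) (F'.updateRow j 0) τ := by
      intro k l
      rcases eq_or_ne k j with rfl | h
      · simpa using hasDerivAt_const τ _
      · simpa [h] using hF k l
    simp only [adjugate_apply]
    exact ⟨_, this.det_adjugate⟩
  choose d hd using hadj
  have hinv : ∃ E, EntryDeriv (fun τ => (F τ)⁻¹) E τ := by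
    choose E hE using fun i j => (⟨_, (hdet.fun_inv h0).fun_mul (hd i j)⟩ :
      ∃ e, HasDerivAt (fun τ => ((F τ).det)⁻¹ * (F τ).adjugate i j) e τ)
    refine ⟨of E, fun i j => ?_⟩
    simpa only [inv_def, Ring.inverse_eq_inv', Matrix.smul_apply, smul_eq_mul, of_apply]
      using hE i j
  obtain ⟨E, hE⟩ := hinv
  have hne : ∀ᶠ τ' in 𝓝 τ, (F τ').det ≠ 0 := hdet.continuousAt.eventually_ne h0
  have h1 : E * F τ + (F τ)⁻¹ * F' = 0 := by
    refine (hE.mul hF).unique (const 1 τ) (hne.mono fun τ' h => ?_)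
    exact nonsing_inv_mul _ (isUnit_iff_ne_zero.2 h)
  have h2 : F τ * (F τ)⁻¹ = 1 := mul_nonsing_inv _ (isUnit_iff_ne_zero.2 h0)
  have h3 : E = -((F τ)⁻¹ * F' * (F τ)⁻¹) := by
    have := congrArg (· * (F τ)⁻¹) h1
    simp only [add_mul, zero_mul, mul_assoc, h2, mul_one] at this
    rw [mul_assoc]
    exact eq_neg_of_add_eq_zero_left this
  exact h3 ▸ hE

end EntryDeriv

end Calculus

/-! ### Derivatives of the resolvents -/

section Resolvent

variable {N : ℕ}

/-- The matrix `c cᵀ`. -/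
def rankOne (p l : Fin N → ℂ) : Matrix (Fin N) (Fin N) ℂ := vecMulVec (cvec p l) (cvec p l)

/-- The resolvent `(1 + ε A)⁻¹`. -/
def res (p : Fin N → ℂ) (ε : ℂ) (l : Fin N → ℂ) : Matrix (Fin N) (Fin N) ℂ :=
  (1 + ε • cauchy p l)⁻¹

/-- The determinant `det (1 + ε A)`. -/
def tau (p : Fin N → ℂ) (ε : ℂ) (l : Fin N → ℂ) : ℂ := (1 + ε • cauchy p l).det

/-- The trace of `K X`. -/
def trRes (p : Fin N → ℂ) (ε : ℂ) (l : Fin N → ℂ) : ℂ := (rankOne p l * res p ε l).trace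

/-- The trace of `K X D X`, the derivative of `trRes` in the direction `d`. -/
def trRes₁ (p : Fin N → ℂ) (ε : ℂ) (d l : Fin N → ℂ) : ℂ :=
  (rankOne p l * res p ε l * diagonal d * res p ε l).trace

/-- The derivative of `trRes₁` in the direction `e`. -/
def trRes₂ (p : Fin N → ℂ) (ε : ℂ) (d e l : Fin N → ℂ) : ℂ :=
  (rankOne p l * res p ε l * diagonal d * res p ε l * diagonal e * res p ε l).trace
    + (rankOne p l * res p ε l * diagonal e * res p ε l * diagonal d * res p ε l).trace
    - (rankOne p l * res p ε l * diagonal d * diagonal e * res p ε l).trace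

theorem diagonal_mul_comm (d e : Fin N → ℂ) :
    diagonal d * diagonal e = diagonal e * diagonal d := by
  simp only [diagonal_mul_diagonal, mul_comm]

theorem trRes₂_comm (p : Fin N → ℂ) (ε : ℂ) (d e l : Fin N → ℂ) :
    trRes₂ p ε d e l = trRes₂ p ε e d l := by
  unfold trRes₂
  rw [mul_assoc (rankOne p l * res p ε l) (diagonal d) (diagonal e), diagonal_mul_comm d e,
    ← mul_assoc]
  ring

variable {p : Fin N → ℂ}

theorem sylvester (hp : ∀ j, p j ≠ 0) (hpp : ∀ j k, j ≠ k → p j + p k ≠ 0) (l : Fin N → ℂ) :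
    diagonal p * cauchy p l + cauchy p l * diagonal p = 2 * rankOne p l := by
  ext i j
  have h := add_ne_zero_of_pairwise hp hpp i j
  simp only [Matrix.add_apply, diagonal_mul, mul_diagonal, cauchy, rankOne, two_mul,
    vecMulVec_apply]
  field_simp

variable {ε : ℂ} {l : Fin N → ℂ}

theorem cauchy_mul_res (h : tau p ε l ≠ 0) :
    (ε • cauchy p l) * res p ε l = 1 - res p ε l := by
  have : (1 + ε • cauchy p l) * res p ε l = 1 := mul_nonsing_inv _ (isUnit_iff_ne_zero.2 h)
  rw [add_mul, one_mul] at this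
  exact eq_sub_of_add_eq' this

theorem res_mul_cauchy (h : tau p ε l ≠ 0) :
    res p ε l * (ε • cauchy p l) = 1 - res p ε l := by
  have : res p ε l * (1 + ε • cauchy p l) = 1 := nonsing_inv_mul _ (isUnit_iff_ne_zero.2 h)
  rw [mul_add, mul_one] at this
  exact eq_sub_of_add_eq' this

theorem relations (hp : ∀ j, p j ≠ 0) (hpp : ∀ j k, j ≠ k → p j + p k ≠ 0) (q : Fin N → ℂ)
    (h1 : tau p 1 l ≠ 0) (h2 : tau p (-1) l ≠ 0) :
    Relations (cauchy p l) (rankOne p l) (diagonal p) (diagonal q) (res p 1 l) (res p (-1) l) where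
  sylvester := sylvester hp hpp l
  rankOne := vecMulVec_mul_mul _
  mul_left := by simpa using cauchy_mul_res h1
  mul_right := by simpa using res_mul_cauchy h1
  mul_left' := by
    have := cauchy_mul_res h2
    rw [neg_one_smul, neg_mul, neg_eq_iff_eq_neg, neg_sub] at this
    exact this
  mul_right' := by
    have := res_mul_cauchy h2
    rw [neg_one_smul, mul_neg, neg_eq_iff_eq_neg, neg_sub] at this
    exact this
  comm := diagonal_mul_comm p q

variable {ℓ : ℝ → Fin N → ℂ} {d : Fin N → ℂ} {τ : ℝ}

theorem cvec_deriv (hℓ : ∀ j, HasDerivAt (fun τ => ℓ τ j) (d j) τ) (j : Fin N) :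
    HasDerivAt (fun τ => cvec p (ℓ τ) j) (cvec p (ℓ τ) j * (d j / 2)) τ :=
  (((hℓ j).const_add _).div_const 2).cexp

theorem rankOne_deriv (hℓ : ∀ j, HasDerivAt (fun τ => ℓ τ j) (d j) τ) :
    EntryDeriv (fun τ => rankOne p (ℓ τ))
      ((1 / 2 : ℂ) • (diagonal d * rankOne p (ℓ τ) + rankOne p (ℓ τ) * diagonal d)) τ := by
  intro i j
  refine ((cvec_deriv hℓ i).fun_mul (cvec_deriv hℓ j)).congr_deriv ?_
  simp only [Matrix.smul_apply, Matrix.add_apply, diagonal_mul, mul_diagonal, rankOne,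
    vecMulVec_apply, smul_eq_mul]
  ring

theorem cauchy_deriv (hℓ : ∀ j, HasDerivAt (fun τ => ℓ τ j) (d j) τ) :
    EntryDeriv (fun τ => cauchy p (ℓ τ))
      ((1 / 2 : ℂ) • (diagonal d * cauchy p (ℓ τ) + cauchy p (ℓ τ) * diagonal d)) τ := by
  intro i j
  refine ((((cvec_deriv (p := p) hℓ i).const_mul 2).fun_mul (cvec_deriv hℓ j)).div_const
    (p i + p j)).congr_deriv ?_
  simp only [Matrix.smul_apply, Matrix.add_apply, diagonal_mul, mul_diagonal, cauchy, smul_eq_mul]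
  ring

theorem one_add_cauchy_deriv (hℓ : ∀ j, HasDerivAt (fun τ => ℓ τ j) (d j) τ) :
    EntryDeriv (fun τ => 1 + ε • cauchy p (ℓ τ))
      ((1 / 2 : ℂ) • (diagonal d * (ε • cauchy p (ℓ τ)) + (ε • cauchy p (ℓ τ)) * diagonal d))
      τ := by
  refine ((EntryDeriv.const 1 τ).add ((cauchy_deriv (p := p) hℓ).const_smul ε)).congr_deriv ?_
  rw [zero_add, mul_smul_comm, smul_mul, ← smul_add, smul_comm]

/-- Jacobi's formula with derivative (DA + AD)/2, ε being absorbed into A: by cyclicity and AX = XA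
= 1 - X both halves contribute the same trace. -/
theorem tau_deriv (hℓ : ∀ j, HasDerivAt (fun τ => ℓ τ j) (d j) τ) (h : tau p ε (ℓ τ) ≠ 0) :
    HasDerivAt (fun τ => tau p ε (ℓ τ))
      (tau p ε (ℓ τ) * (diagonal d * (1 - res p ε (ℓ τ))).trace) τ := by
  refine ((one_add_cauchy_deriv hℓ).det h).congr_deriv ?_
  change tau p ε (ℓ τ) * trace (res p ε (ℓ τ) * _) = _
  congr 1
  set A := ε • cauchy p (ℓ τ) with hA
  set X := res p ε (ℓ τ) with hX
  have e1 : A * X = 1 - X := cauchy_mul_res h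
  have e2 : X * A = 1 - X := res_mul_cauchy h
  rw [mul_smul_comm, mul_add, ← mul_assoc, ← mul_assoc, e2, trace_smul, trace_add,
    mul_assoc X, trace_mul_comm X, mul_assoc, e1, trace_mul_comm (1 - X), smul_eq_mul]
  ring

theorem res_deriv (hℓ : ∀ j, HasDerivAt (fun τ => ℓ τ j) (d j) τ) (h : tau p ε (ℓ τ) ≠ 0) :
    EntryDeriv (fun τ => res p ε (ℓ τ))
      (res p ε (ℓ τ) * diagonal d * res p ε (ℓ τ)
        - (1 / 2 : ℂ) • (res p ε (ℓ τ) * diagonal d + diagonal d * res p ε (ℓ τ))) τ := by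
  refine ((one_add_cauchy_deriv hℓ).inv h).congr_deriv ?_
  change -(res p ε (ℓ τ) * _ * res p ε (ℓ τ)) = _
  set A := ε • cauchy p (ℓ τ) with hA
  set X := res p ε (ℓ τ) with hX
  have e1 : A * X = 1 - X := cauchy_mul_res h
  have e2 : X * A = 1 - X := res_mul_cauchy h
  rw [mul_smul_comm, smul_mul, mul_add, add_mul, ← mul_assoc, ← mul_assoc, e2, mul_assoc _ A X, e1,
    sub_mul, sub_mul, mul_sub, one_mul, mul_one]
  module

/-- The derivative of the resolvent in the direction `p`. -/
theorem res_deriv_self (hp : ∀ j, p j ≠ 0) (hpp : ∀ j k, j ≠ k → p j + p k ≠ 0)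
    (hℓ : ∀ j, HasDerivAt (fun τ => ℓ τ j) (p j) τ) (h : tau p ε (ℓ τ) ≠ 0) :
    EntryDeriv (fun τ => res p ε (ℓ τ))
      (-(ε • (res p ε (ℓ τ) * rankOne p (ℓ τ) * res p ε (ℓ τ)))) τ := by
  refine ((one_add_cauchy_deriv hℓ).inv h).congr_deriv ?_
  change -(res p ε (ℓ τ) * _ * res p ε (ℓ τ)) = _
  -- In the direction p the derivative of A is K itself, by the Sylvester equation.
  have e1 : diagonal p * (ε • cauchy p (ℓ τ)) + (ε • cauchy p (ℓ τ)) * diagonal p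
      = (2 * ε) • rankOne p (ℓ τ) := by
    rw [mul_smul_comm, smul_mul, ← smul_add, sylvester hp hpp, two_mul]
    module
  rw [e1, smul_smul, mul_smul_comm, smul_mul]
  congr 2
  ring

/-- The symmetrised halves coming from K and from X cancel under the trace, leaving only tr KXDX. -/
theorem trRes_deriv (hℓ : ∀ j, HasDerivAt (fun τ => ℓ τ j) (d j) τ) (h : tau p ε (ℓ τ) ≠ 0) :
    HasDerivAt (fun τ => trRes p ε (ℓ τ)) (trRes₁ p ε d (ℓ τ)) τ := by
  refine (((rankOne_deriv (p := p) hℓ).mul (res_deriv hℓ h)).trace).congr_deriv ?_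
  rw [trRes₁]
  set K := rankOne p (ℓ τ)
  set X := res p ε (ℓ τ)
  have c1 : (diagonal d * K * X).trace = (K * X * diagonal d).trace := by
    rw [mul_assoc, trace_mul_comm]
  simp only [smul_mul, mul_smul_comm, mul_add, add_mul, mul_sub, trace_add, trace_sub,
    trace_smul, smul_eq_mul, ← mul_assoc]
  linear_combination c1 / 2

theorem trRes₁_deriv (e : Fin N → ℂ) (hℓ : ∀ j, HasDerivAt (fun τ => ℓ τ j) (d j) τ)
    (h : tau p ε (ℓ τ) ≠ 0) :
    HasDerivAt (fun τ => trRes₁ p ε e (ℓ τ)) (trRes₂ p ε e d (ℓ τ)) τ := by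
  have hX := res_deriv hℓ h
  refine (((((rankOne_deriv (p := p) hℓ).mul hX).mul_const (diagonal e)).mul hX).trace).congr_deriv ?_
  rw [trRes₂]
  set K := rankOne p (ℓ τ)
  set X := res p ε (ℓ τ)
  have c1 : (diagonal d * K * X * diagonal e * X).trace
      = (K * X * diagonal e * X * diagonal d).trace := by
    rw [show diagonal d * K * X * diagonal e * X = diagonal d * (K * X * diagonal e * X) by
      simp only [mul_assoc], trace_mul_comm]
  have c2 : K * X * diagonal d * diagonal e = K * X * diagonal e * diagonal d := by
    rw [mul_assoc (K * X), diagonal_mul_comm, mul_assoc (K * X)]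
  simp only [smul_mul, mul_smul_comm, mul_add, add_mul, mul_sub, sub_mul, trace_add, trace_sub,
    trace_smul, smul_eq_mul, ← mul_assoc, c2]
  linear_combination c1 / 2

/-- Taken with e = p²q and ε = ±1, this makes the x-derivative of tr P²Q(X - Y) equal to 4u_t. -/
theorem trace_diagonal_mul_res_deriv (hp : ∀ j, p j ≠ 0) (hpp : ∀ j k, j ≠ k → p j + p k ≠ 0)
    (e : Fin N → ℂ)
    (hℓ : ∀ j, HasDerivAt (fun τ => ℓ τ j) (p j) τ) (h : tau p ε (ℓ τ) ≠ 0) :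
    HasDerivAt (fun τ => (diagonal e * res p ε (ℓ τ)).trace) (-ε * trRes₁ p ε e (ℓ τ)) τ := by
  refine ((EntryDeriv.const_mul (diagonal e) (res_deriv_self hp hpp hℓ h)).trace).congr_deriv ?_
  rw [trRes₁]
  set K := rankOne p (ℓ τ)
  set X := res p ε (ℓ τ)
  rw [mul_neg, trace_neg, mul_smul_comm, trace_smul, smul_eq_mul, neg_mul]
  congr 2
  rw [show diagonal e * (X * K * X) = (diagonal e * X) * (K * X) by
    simp only [mul_assoc], trace_mul_comm]
  simp only [mul_assoc]

/-- `tr K X = ε tr P (1 - X)`. -/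
theorem trRes_eq (hp : ∀ j, p j ≠ 0) (hpp : ∀ j k, j ≠ k → p j + p k ≠ 0)
    (h : tau p ε l ≠ 0) :
    ε * trRes p ε l = (diagonal p * (1 - res p ε l)).trace := by
  have e1 := cauchy_mul_res h
  have e2 := res_mul_cauchy h
  have e3 := congrArg (fun M => (ε • M * res p ε l).trace) (sylvester hp hpp l)
  simp only [smul_add, ← mul_smul_comm, add_mul, mul_assoc, e1, two_mul] at e3
  rw [trRes]
  simp only [smul_mul, mul_smul_comm] at e1 e2 e3
  have c1 : ε • (cauchy p l * (diagonal p * res p ε l)).trace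
      = (diagonal p * (1 - res p ε l)).trace := by
    rw [trace_mul_comm, ← trace_smul, mul_assoc, ← mul_smul_comm, e2]
  simp only [trace_add, trace_smul, c1] at e3
  simp only [smul_eq_mul] at e3
  linear_combination -e3 / 2

end Resolvent

end CKdV
end

noncomputable section

namespace CKdV

open Matrix

/-! ### Partial derivatives on open sets -/

section Partial

variable {D : Set (ℝ × ℝ × ℝ)} {u u' w w' : ℝ → ℝ → ℝ → ℂ}

/-- `u'` is the partial derivative of `u` in `x` on `D`. -/
def PartialX (D : Set (ℝ × ℝ × ℝ)) (u u' : ℝ → ℝ → ℝ → ℂ) : Prop :=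
  ∀ x z t, (x, z, t) ∈ D → HasDerivAt (fun x' : ℝ => u x' z t) (u' x z t) x

/-- `u'` is the partial derivative of `u` in `z` on `D`. -/
def PartialZ (D : Set (ℝ × ℝ × ℝ)) (u u' : ℝ → ℝ → ℝ → ℂ) : Prop :=
  ∀ x z t, (x, z, t) ∈ D → HasDerivAt (fun z' : ℝ => u x z' t) (u' x z t) z

/-- `u'` is the partial derivative of `u` in `t` on `D`. -/
def PartialT (D : Set (ℝ × ℝ × ℝ)) (u u' : ℝ → ℝ → ℝ → ℂ) : Prop :=
  ∀ x z t, (x, z, t) ∈ D → HasDerivAt (fun t' : ℝ => u x z t') (u' x z t) t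

/-- Two functions agree on `D`. -/
def AgreeOn (D : Set (ℝ × ℝ × ℝ)) (u w : ℝ → ℝ → ℝ → ℂ) : Prop :=
  ∀ x z t, (x, z, t) ∈ D → u x z t = w x z t

theorem eventually_mem_x (hD : IsOpen D) {x z t : ℝ} (h : (x, z, t) ∈ D) :
    ∀ᶠ x' in 𝓝 x, (x', z, t) ∈ D :=
  (Continuous.prodMk_left (X := ℝ) (z, t)).continuousAt.eventually (hD.mem_nhds h)

theorem eventually_mem_z (hD : IsOpen D) {x z t : ℝ} (h : (x, z, t) ∈ D) :
    ∀ᶠ z' in 𝓝 z, (x, z', t) ∈ D :=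
  (show Continuous fun z' : ℝ => (x, z', t) by fun_prop).continuousAt.eventually (hD.mem_nhds h)

theorem eventually_mem_t (hD : IsOpen D) {x z t : ℝ} (h : (x, z, t) ∈ D) :
    ∀ᶠ t' in 𝓝 t, (x, z, t') ∈ D :=
  (show Continuous fun t' : ℝ => (x, z, t') by fun_prop).continuousAt.eventually (hD.mem_nhds h)

theorem PartialX.dx_eq (h : PartialX D u u') : AgreeOn D (dx u) u' :=
  fun _ _ _ hy => (h _ _ _ hy).deriv

theorem PartialZ.dz_eq (h : PartialZ D u u') : AgreeOn D (dz u) u' :=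
  fun _ _ _ hy => (h _ _ _ hy).deriv

theorem PartialT.dt_eq (h : PartialT D u u') : AgreeOn D (dt u) u' :=
  fun _ _ _ hy => (h _ _ _ hy).deriv

theorem PartialX.congr (h : PartialX D u u') (hD : IsOpen D) (e : AgreeOn D w u)
    (e' : AgreeOn D u' w') : PartialX D w w' := fun _ _ _ hy =>
  e' _ _ _ hy ▸ (h _ _ _ hy).congr_of_eventuallyEq
    ((eventually_mem_x hD hy).mono fun _ hx => e _ _ _ hx)

theorem PartialZ.congr (h : PartialZ D u u') (hD : IsOpen D) (e : AgreeOn D w u)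
    (e' : AgreeOn D u' w') : PartialZ D w w' := fun _ _ _ hy =>
  e' _ _ _ hy ▸ (h _ _ _ hy).congr_of_eventuallyEq
    ((eventually_mem_z hD hy).mono fun _ hx => e _ _ _ hx)

theorem PartialT.congr (h : PartialT D u u') (hD : IsOpen D) (e : AgreeOn D w u)
    (e' : AgreeOn D u' w') : PartialT D w w' := fun _ _ _ hy =>
  e' _ _ _ hy ▸ (h _ _ _ hy).congr_of_eventuallyEq
    ((eventually_mem_t hD hy).mono fun _ hx => e _ _ _ hx)

theorem AgreeOn.rfl : AgreeOn D u u := fun _ _ _ _ => Eq.refl _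

theorem AgreeOn.symm (h : AgreeOn D u w) : AgreeOn D w u := fun _ _ _ hy => (h _ _ _ hy).symm

theorem AgreeOn.dx (hD : IsOpen D) (h : AgreeOn D u w) : AgreeOn D (dx u) (dx w) :=
  fun _ _ _ hy => Filter.EventuallyEq.deriv_eq
    ((eventually_mem_x hD hy).mono fun _ hx => h _ _ _ hx)

theorem AgreeOn.dz (hD : IsOpen D) (h : AgreeOn D u w) : AgreeOn D (dz u) (dz w) :=
  fun _ _ _ hy => Filter.EventuallyEq.deriv_eq
    ((eventually_mem_z hD hy).mono fun _ hx => h _ _ _ hx)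

theorem SmoothOn.congr (h : SmoothOn D u) (e : AgreeOn D w u) : SmoothOn D w :=
  ContDiffOn.congr h fun y hy => e y.1 y.2.1 y.2.2 hy

theorem SmoothOn.differentiableAt (h : SmoothOn D u) (hD : IsOpen D) {y : ℝ × ℝ × ℝ} (hy : y ∈ D) :
    DifferentiableAt ℝ (fun y : ℝ × ℝ × ℝ => u y.1 y.2.1 y.2.2) y :=
  (ContDiffOn.contDiffAt h (hD.mem_nhds hy)).differentiableAt (by simp)

theorem hasDerivAt_line_x (x z t : ℝ) :
    HasDerivAt (fun x' : ℝ => (x', z, t)) ((1, 0, 0) : ℝ × ℝ × ℝ) x :=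
  (hasDerivAt_id x).prodMk ((hasDerivAt_const x z).prodMk (hasDerivAt_const x t))

theorem hasDerivAt_line_z (x z t : ℝ) :
    HasDerivAt (fun z' : ℝ => (x, z', t)) ((0, 1, 0) : ℝ × ℝ × ℝ) z :=
  (hasDerivAt_const z x).prodMk ((hasDerivAt_id z).prodMk (hasDerivAt_const z t))

theorem hasDerivAt_comp_line_x {G : Type*} [NormedAddCommGroup G] [NormedSpace ℝ G]
    {F : ℝ × ℝ × ℝ → G} {x z t : ℝ} (h : DifferentiableAt ℝ F (x, z, t)) :
    HasDerivAt (fun x' : ℝ => F (x', z, t)) (fderiv ℝ F (x, z, t) (1, 0, 0)) x :=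
  HasFDerivAt.comp_hasDerivAt (f := fun x' : ℝ => (x', z, t)) x h.hasFDerivAt
    (hasDerivAt_line_x x z t)

theorem hasDerivAt_comp_line_z {G : Type*} [NormedAddCommGroup G] [NormedSpace ℝ G]
    {F : ℝ × ℝ × ℝ → G} {x z t : ℝ} (h : DifferentiableAt ℝ F (x, z, t)) :
    HasDerivAt (fun z' : ℝ => F (x, z', t)) (fderiv ℝ F (x, z, t) (0, 1, 0)) z :=
  HasFDerivAt.comp_hasDerivAt (f := fun z' : ℝ => (x, z', t)) z h.hasFDerivAt
    (hasDerivAt_line_z x z t)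

theorem SmoothOn.hasDerivAt_x (h : SmoothOn D u) (hD : IsOpen D) {x z t : ℝ}
    (hy : (x, z, t) ∈ D) :
    HasDerivAt (fun x' : ℝ => u x' z t)
      (fderiv ℝ (fun y : ℝ × ℝ × ℝ => u y.1 y.2.1 y.2.2) (x, z, t) (1, 0, 0)) x :=
  hasDerivAt_comp_line_x (h.differentiableAt hD hy)

theorem SmoothOn.hasDerivAt_z (h : SmoothOn D u) (hD : IsOpen D) {x z t : ℝ}
    (hy : (x, z, t) ∈ D) :
    HasDerivAt (fun z' : ℝ => u x z' t)
      (fderiv ℝ (fun y : ℝ × ℝ × ℝ => u y.1 y.2.1 y.2.2) (x, z, t) (0, 1, 0)) z :=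
  hasDerivAt_comp_line_z (h.differentiableAt hD hy)

theorem SmoothOn.partialX (h : SmoothOn D u) (hD : IsOpen D) : PartialX D u (dx u) :=
  fun _ _ _ hy => (h.hasDerivAt_x hD hy).differentiableAt.hasDerivAt

theorem SmoothOn.partialZ (h : SmoothOn D u) (hD : IsOpen D) : PartialZ D u (dz u) :=
  fun _ _ _ hy => (h.hasDerivAt_z hD hy).differentiableAt.hasDerivAt

theorem SmoothOn.dx (h : SmoothOn D u) (hD : IsOpen D) : SmoothOn D (dx u) :=
  ((ContDiffOn.fderiv_of_isOpen h hD (m := ∞) (by simp)).clm_apply contDiffOn_const).congr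
    fun _ hy => (h.hasDerivAt_x hD hy).deriv

theorem SmoothOn.dz (h : SmoothOn D u) (hD : IsOpen D) : SmoothOn D (dz u) :=
  ((ContDiffOn.fderiv_of_isOpen h hD (m := ∞) (by simp)).clm_apply contDiffOn_const).congr
    fun _ hy => (h.hasDerivAt_z hD hy).deriv

/-- Partial derivatives of smooth functions commute. -/
theorem SmoothOn.dz_dx (h : SmoothOn D u) (hD : IsOpen D) :
    AgreeOn D (CKdV.dz (CKdV.dx u)) (CKdV.dx (CKdV.dz u)) := by
  intro x z t hy
  set U : ℝ × ℝ × ℝ → ℂ := fun y => u y.1 y.2.1 y.2.2 with hU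
  have hsymm : IsSymmSndFDerivAt ℝ U (x, z, t) :=
    (ContDiffOn.contDiffAt h (hD.mem_nhds hy)).isSymmSndFDerivAt
      (by simpa using WithTop.coe_le_coe.2 (le_top (a := (2 : ℕ∞))))
  have hd : DifferentiableAt ℝ (fderiv ℝ U) (x, z, t) :=
    ((ContDiffOn.fderiv_of_isOpen h hD (m := ∞) (by simp)).contDiffAt
      (hD.mem_nhds hy)).differentiableAt (by simp)
  have e1 : HasDerivAt (fun z' : ℝ => fderiv ℝ U (x, z', t) (1, 0, 0))
      (fderiv ℝ (fderiv ℝ U) (x, z, t) (0, 1, 0) (1, 0, 0)) z := by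
    have := (hasDerivAt_comp_line_z hd).clm_apply
      (hasDerivAt_const z ((1, 0, 0) : ℝ × ℝ × ℝ))
    simpa only [map_zero, add_zero] using this
  have e2 : HasDerivAt (fun x' : ℝ => fderiv ℝ U (x', z, t) (0, 1, 0))
      (fderiv ℝ (fderiv ℝ U) (x, z, t) (1, 0, 0) (0, 1, 0)) x := by
    have := (hasDerivAt_comp_line_x hd).clm_apply
      (hasDerivAt_const x ((0, 1, 0) : ℝ × ℝ × ℝ))
    simpa only [map_zero, add_zero] using this
  have e3 : CKdV.dz (CKdV.dx u) x z t = fderiv ℝ (fderiv ℝ U) (x, z, t) (0, 1, 0) (1, 0, 0) := by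
    refine (e1.congr_of_eventuallyEq ?_).deriv
    exact (eventually_mem_z hD hy).mono fun z' hz => (h.hasDerivAt_x hD hz).deriv
  have e4 : CKdV.dx (CKdV.dz u) x z t = fderiv ℝ (fderiv ℝ U) (x, z, t) (1, 0, 0) (0, 1, 0) := by
    refine (e2.congr_of_eventuallyEq ?_).deriv
    exact (eventually_mem_x hD hy).mono fun x' hx => (h.hasDerivAt_z hD hx).deriv
  rw [e3, e4, hsymm.eq]

end Partial

/-! ### Sums of exponentials -/

section ExpSum

variable {N : ℕ} (p q s : Fin N → ℂ)

/-- The sum of the `a_S exp (∑_{i ∈ S} λ_i)` over all `S`. -/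
def expSum (a : Finset (Fin N) → ℂ) (x z t : ℝ) : ℂ :=
  ∑ S : Finset (Fin N), a S * Complex.exp (∑ i ∈ S, lam p q s i x z t)

theorem f_eq_expSum : f p q s = expSum p q s (etaProd p) := by
  funext x z t
  rw [f, fSub, Finset.powerset_univ, expSum]

theorem g_eq_expSum : g p q s = expSum p q s fun S => (-1) ^ S.card * etaProd p S := rfl

theorem H_eq_expSum :
    H p q s = expSum p q s fun S => 4 * ∑ n ∈ Finset.univ \ S, etaProd p S / p n := by
  funext x z t
  simp only [H, fSub, expSum, mul_assoc (4 : ℂ), ← Finset.mul_sum]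
  congr 1
  simp only [Finset.sum_mul, Finset.sum_div]
  rw [Finset.sum_sigma', Finset.sum_sigma']
  refine Finset.sum_bij' (fun y _ => ⟨y.2, y.1⟩) (fun y _ => ⟨y.2, y.1⟩) ?_ ?_ ?_ ?_ ?_
  · rintro ⟨n, S⟩ h
    simp only [Finset.mem_sigma, Finset.mem_univ, true_and, Finset.mem_powerset,
      Finset.mem_sdiff] at h ⊢
    exact fun hn => Finset.notMem_erase n _ (h hn)
  · rintro ⟨S, n⟩ h
    simp only [Finset.mem_sigma, Finset.mem_univ, true_and, Finset.mem_powerset,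
      Finset.mem_sdiff] at h ⊢
    exact fun i hi => Finset.mem_erase.2 ⟨fun e => h (e ▸ hi), Finset.mem_univ _⟩
  · intros; rfl
  · intros; rfl
  · intros; simp only; ring

theorem lam_hasDerivAt_x (j : Fin N) (x z t : ℝ) :
    HasDerivAt (fun x' : ℝ => lam p q s j x' z t) (p j) x := by
  refine HasDerivAt.congr_deriv (((((Complex.ofRealCLM.hasDerivAt (x := x)).const_mul (p j)).add_const (q j * z)).add_const
    ((-(1 / 4) * p j ^ 2 * q j) * t)).add_const (s j)) ?_
  simp

theorem lam_hasDerivAt_z (j : Fin N) (x z t : ℝ) :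
    HasDerivAt (fun z' : ℝ => lam p q s j x z' t) (q j) z := by
  refine HasDerivAt.congr_deriv (((((Complex.ofRealCLM.hasDerivAt (x := z)).const_mul (q j)).const_add (p j * x)).add_const
    ((-(1 / 4) * p j ^ 2 * q j) * t)).add_const (s j)) ?_
  simp

theorem lam_hasDerivAt_t (j : Fin N) (x z t : ℝ) :
    HasDerivAt (fun t' : ℝ => lam p q s j x z t') (-(1 / 4) * p j ^ 2 * q j) t := by
  refine HasDerivAt.congr_deriv (((((Complex.ofRealCLM.hasDerivAt (x := t)).const_mul
    (-(1 / 4) * p j ^ 2 * q j))).const_add (p j * x + q j * z)).add_const (s j)) ?_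
  simp

theorem expSum_hasDerivAt_x (a : Finset (Fin N) → ℂ) (x z t : ℝ) :
    HasDerivAt (fun x' : ℝ => expSum p q s a x' z t)
      (expSum p q s (fun S => (∑ i ∈ S, p i) * a S) x z t) x := by
  refine (HasDerivAt.fun_sum fun S _ => ((HasDerivAt.fun_sum fun i _ =>
    lam_hasDerivAt_x p q s i x z t).cexp.const_mul (a S))).congr_deriv ?_
  exact Finset.sum_congr rfl fun S _ => by ring

theorem expSum_hasDerivAt_z (a : Finset (Fin N) → ℂ) (x z t : ℝ) :
    HasDerivAt (fun z' : ℝ => expSum p q s a x z' t)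
      (expSum p q s (fun S => (∑ i ∈ S, q i) * a S) x z t) z := by
  refine (HasDerivAt.fun_sum fun S _ => ((HasDerivAt.fun_sum fun i _ =>
    lam_hasDerivAt_z p q s i x z t).cexp.const_mul (a S))).congr_deriv ?_
  exact Finset.sum_congr rfl fun S _ => by ring

theorem expSum_contDiff (a : Finset (Fin N) → ℂ) :
    ContDiff ℝ ∞ fun y : ℝ × ℝ × ℝ => expSum p q s a y.1 y.2.1 y.2.2 := by
  have hc : ContDiff ℝ ∞ (fun r : ℝ => (r : ℂ)) := Complex.ofRealCLM.contDiff
  unfold expSum lam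
  have h1 : ContDiff ℝ ∞ fun y : ℝ × ℝ × ℝ => (y.1 : ℂ) := hc.comp contDiff_fst
  have h2 : ContDiff ℝ ∞ fun y : ℝ × ℝ × ℝ => (y.2.1 : ℂ) :=
    hc.comp (contDiff_fst.comp contDiff_snd)
  have h3 : ContDiff ℝ ∞ fun y : ℝ × ℝ × ℝ => (y.2.2 : ℂ) :=
    hc.comp (contDiff_snd.comp contDiff_snd)
  exact ContDiff.sum fun S _ => contDiff_const.mul (ContDiff.cexp (ContDiff.sum fun i _ =>
    (((contDiff_const.mul h1).add (contDiff_const.mul h2)).add (contDiff_const.mul h3)).add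
      contDiff_const))

theorem expSum_smoothOn (D : Set (ℝ × ℝ × ℝ)) (a : Finset (Fin N) → ℂ) :
    SmoothOn D (expSum p q s a) := (expSum_contDiff p q s a).contDiffOn

theorem isOpen_domV : IsOpen (domV p q s) := by
  have hf := (expSum_contDiff p q s (etaProd p)).continuous
  have hg := (expSum_contDiff p q s fun S => (-1) ^ S.card * etaProd p S).continuous
  rw [← f_eq_expSum] at hf
  rw [← g_eq_expSum] at hg
  exact (isOpen_ne_fun hf continuous_const).inter (isOpen_ne_fun hg continuous_const)

/-- The vector of the `λ_j`. -/
def lamVec (p q s : Fin N → ℂ) (x z t : ℝ) : Fin N → ℂ := fun j => lam p q s j x z t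

theorem f_eq_tau {p q s : Fin N → ℂ} (hp : ∀ j, p j ≠ 0)
    (hpp : ∀ j k, j ≠ k → p j + p k ≠ 0) (x z t : ℝ) :
    f p q s x z t = tau p 1 (lamVec p q s x z t) := by
  rw [tau, det_one_add_smul_cauchy hp hpp, f_eq_expSum]
  simp only [one_pow, one_mul, expSum, lamVec]

theorem g_eq_tau {p q s : Fin N → ℂ} (hp : ∀ j, p j ≠ 0)
    (hpp : ∀ j k, j ≠ k → p j + p k ≠ 0) (x z t : ℝ) :
    g p q s x z t = tau p (-1) (lamVec p q s x z t) := by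
  rw [tau, det_one_add_smul_cauchy hp hpp, g]
  simp only [lamVec]

theorem Phi_eq {p q s : Fin N → ℂ} (hp : ∀ j, p j ≠ 0)
    (hpp : ∀ j k, j ≠ k → p j + p k ≠ 0) (x z t : ℝ) :
    Phi p q s x z t
      = x + 4 * (diagonal p⁻¹ * res p 1 (lamVec p q s x z t)).trace := by
  rw [Phi, f_eq_tau hp hpp, H, show lamVec p q s x z t = fun j => lam p q s j x z t from rfl]
  simp only [fSub_erase_eq_adjugate hp hpp, res, tau, one_smul, inv_def, Ring.inverse_eq_inv',
    trace, diag_apply, diagonal_mul, Matrix.smul_apply, smul_eq_mul, Pi.inv_apply]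
  rw [mul_div_assoc, Finset.sum_div]
  congr 2
  exact Finset.sum_congr rfl fun n _ => by ring

end ExpSum

end CKdV
end

noncomputable section

namespace CKdV

open Matrix

/-! ### From the bilinear equations to the modified CBS and the Calogero-KdV equation -/

section Abstract

variable {D : Set (ℝ × ℝ × ℝ)}

/-- The equations satisfied by `u = (log (f / g))_x` and `C = (log (f g))_xz`. -/
structure FlowData (D : Set (ℝ × ℝ × ℝ)) (u ux uz ut C V V' F : ℝ → ℝ → ℝ → ℂ) : Prop where
  isOpen : IsOpen D
  smooth : SmoothOn D u
  partialX : PartialX D u ux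
  partialZ : PartialZ D u uz
  partialT : PartialT D u ut
  partialZ_ux : PartialZ D ux V
  partialX_F : PartialX D F fun x z t => 4 * ut x z t
  partialX_C : PartialX D C V'
  flow : ∀ x z t, (x, z, t) ∈ D → F x z t + V x z t + 2 * u x z t * C x z t = 0
  miura : ∀ x z t, (x, z, t) ∈ D → V' x z t = -2 * u x z t * uz x z t

variable {u ux uz ut C V V' F : ℝ → ℝ → ℝ → ℂ} (h : FlowData D u ux uz ut C V V' F)

include h

theorem FlowData.mono {E : Set (ℝ × ℝ × ℝ)} (hE : IsOpen E) (hED : E ⊆ D) :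
    FlowData E u ux uz ut C V V' F where
  isOpen := hE
  smooth := ContDiffOn.mono h.smooth hED
  partialX x z t hy := h.partialX x z t (hED hy)
  partialZ x z t hy := h.partialZ x z t (hED hy)
  partialT x z t hy := h.partialT x z t (hED hy)
  partialZ_ux x z t hy := h.partialZ_ux x z t (hED hy)
  partialX_F x z t hy := h.partialX_F x z t (hED hy)
  partialX_C x z t hy := h.partialX_C x z t (hED hy)
  flow x z t hy := h.flow x z t (hED hy)
  miura x z t hy := h.miura x z t (hED hy)

/-- Solve the flow equation for V = u_xz, differentiate in x, and replace C_x by -(u²)_z. -/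
theorem FlowData.partialX_V :
    PartialX D V fun x z t => -4 * ut x z t - 2 * ux x z t * C x z t
      + 4 * u x z t ^ 2 * uz x z t := by
  have h1 : PartialX D (fun x z t => -F x z t - 2 * (u x z t * C x z t))
      (fun x z t => -(4 * ut x z t) - 2 * (ux x z t * C x z t + u x z t * V' x z t)) :=
    fun x z t hy => (h.partialX_F x z t hy).neg.sub
      (((h.partialX x z t hy).mul (h.partialX_C x z t hy)).const_mul 2)
  refine h1.congr h.isOpen (fun x z t hy => ?_) (fun x z t hy => ?_)
  · linear_combination h.flow x z t hy
  · linear_combination (-2 * u x z t) * h.miura x z t hy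

theorem FlowData.dz_dx_dx : AgreeOn D (dz (dx (dx u))) fun x z t => -4 * ut x z t
    - 2 * ux x z t * C x z t + 4 * u x z t ^ 2 * uz x z t := by
  intro x z t hy
  rw [(h.smooth.dx h.isOpen).dz_dx h.isOpen x z t hy]
  have h1 : PartialZ D (dx u) V := h.partialZ_ux.congr h.isOpen h.partialX.dx_eq AgreeOn.rfl
  rw [h1.dz_eq.dx h.isOpen x z t hy]
  exact h.partialX_V.dx_eq x z t hy

/-- Here v² = -u², so C is a primitive of (v²)_z by the Miura relation. Only σ² matters for C, hence
the same C serves -σ. -/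
theorem FlowData.solvesMCBS {σ : ℂ} (hσ : σ ^ 2 = -1) :
    SolvesMCBS D (fun x z t => σ * u x z t) C := by
  refine ⟨h.isOpen, contDiffOn_const.mul h.smooth, ?_, ?_⟩
  · refine PartialX.congr h.partialX_C h.isOpen AgreeOn.rfl fun x z t hy => ?_
    have h1 : PartialZ D (fun x z t => (σ * u x z t) ^ 2)
        fun x z t => -2 * u x z t * uz x z t := fun x z t hy => by
      refine (((h.partialZ x z t hy).const_mul σ).fun_pow 2).congr_deriv ?_
      norm_num
      linear_combination (2 * u x z t * uz x z t) * hσ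
    rw [h1.dz_eq x z t hy, h.miura x z t hy]
  · intro x z t hy
    have e1 : dt (fun x z t => σ * u x z t) x z t = σ * ut x z t :=
      ((h.partialT x z t hy).const_mul σ).deriv
    have e2 : dz (fun x z t => σ * u x z t) x z t = σ * uz x z t :=
      ((h.partialZ x z t hy).const_mul σ).deriv
    have e3 : dx (fun x z t => σ * u x z t) = fun x z t => σ * dx u x z t := by
      funext x z t
      exact deriv_const_mul_field σ
    have e4 : dx (fun x z t => σ * dx u x z t) = fun x z t => σ * dx (dx u) x z t := by
      funext x z t
      exact deriv_const_mul_field σ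
    have e5 : dz (fun x z t => σ * dx (dx u) x z t) x z t = σ * dz (dx (dx u)) x z t :=
      deriv_const_mul_field σ
    rw [e3, e4, e5, e1, e2, h.dz_dx_dx x z t hy]
    simp only [h.partialX.dx_eq x z t hy]
    linear_combination (σ * u x z t ^ 2 * uz x z t) * hσ

variable {w b : ℝ → ℝ → ℝ → ℂ} {σ : ℂ} (hσ : σ ^ 2 = -1) (hw : SmoothOn D w)
  (hw0 : ∀ x z t, (x, z, t) ∈ D → w x z t ≠ 0)
  (hwx : PartialX D w fun x z t => 2 * u x z t * w x z t + σ)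
  (hwt : PartialT D w fun x z t => F x z t * w x z t / 2 + σ * b x z t)
  (hb : ∀ x z t, (x, z, t) ∈ D → C x z t = uz x z t - 2 * b x z t)

include hσ hw hw0 hwx hwt hb

/-- Squaring w_x/w = 2u + σ/w writes w_x²/w² through u², (1/w)_x and 1/w². The z-derivatives of
these have the primitives -C, (1/w)_z and A, which dictates the second antiderivative. Since the
equation sees only the difference of the two, A stays arbitrary. -/
theorem FlowData.solvesCKdV {A : ℝ → ℝ → ℝ → ℂ}
    (hA : IsXPrimitiveOn D (dz fun x z t => 1 / w x z t ^ 2) A) :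
    SolvesCKdV D w A fun x z t =>
      A x z t - 4 * C x z t - 2 * σ * dz (fun x z t => (w x z t)⁻¹) x z t := by
  have hwz := hw.partialZ h.isOpen
  have hinv : SmoothOn D fun x z t => (w x z t)⁻¹ :=
    ContDiffOn.inv hw fun y hy => hw0 y.1 y.2.1 y.2.2 hy
  have hinvx : PartialX D (fun x z t => (w x z t)⁻¹)
      fun x z t => -(2 * u x z t * w x z t + σ) / w x z t ^ 2 :=
    fun x z t hy => (hwx x z t hy).inv (hw0 x z t hy)
  have hinvz : PartialZ D (fun x z t => (w x z t)⁻¹) fun x z t => -dz w x z t / w x z t ^ 2 :=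
    fun x z t hy => (hwz x z t hy).inv (hw0 x z t hy)
  have hinv2 : SmoothOn D fun x z t => 1 / w x z t ^ 2 :=
    SmoothOn.congr (u := fun x z t => (w x z t)⁻¹ ^ 2) (ContDiffOn.pow hinv 2)
      fun x z t _ => by simp only [one_div, inv_pow]
  refine ⟨h.isOpen, hw, hw0, hA, ?_, ?_⟩
  · -- `w_x² / w² = 4 u² - 2 σ (1 / w)_x + 1 / w²`
    have k1 : AgreeOn D (fun x z t => dx w x z t ^ 2 / w x z t ^ 2)
        fun x z t => 4 * u x z t ^ 2 - 2 * σ * dx (fun x z t => (w x z t)⁻¹) x z t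
          + 1 / w x z t ^ 2 := by
      intro x z t hy
      have := hw0 x z t hy
      simp only [hwx.dx_eq x z t hy, hinvx.dx_eq x z t hy]
      field_simp
      linear_combination -hσ
    have k2 : PartialX D
        (fun x z t => A x z t - 4 * C x z t - 2 * σ * dz (fun x z t => (w x z t)⁻¹) x z t)
        fun x z t => dz (fun x z t => 1 / w x z t ^ 2) x z t - 4 * V' x z t
          - 2 * σ * dx (dz fun x z t => (w x z t)⁻¹) x z t := fun x z t hy =>
      ((hA x z t hy).sub ((h.partialX_C x z t hy).const_mul 4)).sub
        (((hinv.dz h.isOpen).partialX h.isOpen x z t hy).const_mul _)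
    refine PartialX.congr k2 h.isOpen AgreeOn.rfl fun x z t hy => ?_
    have k3 : PartialZ D (fun x z t => 4 * u x z t ^ 2
          - 2 * σ * dx (fun x z t => (w x z t)⁻¹) x z t + 1 / w x z t ^ 2)
        fun x z t => 4 * (2 * u x z t * uz x z t)
          - 2 * σ * dz (dx fun x z t => (w x z t)⁻¹) x z t
          + dz (fun x z t => 1 / w x z t ^ 2) x z t := fun x z t hy => by
      have k4 := (h.partialZ x z t hy).fun_pow 2
      norm_num at k4
      exact ((k4.const_mul 4).sub
        (((hinv.dx h.isOpen).partialZ h.isOpen x z t hy).const_mul _)).add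
          (hinv2.partialZ h.isOpen x z t hy)
    rw [k1.dz h.isOpen x z t hy, k3.dz_eq x z t hy]
    simp only [hinv.dz_dx h.isOpen x z t hy]
    linear_combination -4 * h.miura x z t hy
  · intro x z t hy
    have hwxx : PartialX D (dx w) fun x z t => 2 * (ux x z t * w x z t
        + u x z t * (2 * u x z t * w x z t + σ)) := by
      have : PartialX D (fun x z t => 2 * (u x z t * w x z t) + σ) fun x z t =>
          2 * (ux x z t * w x z t + u x z t * (2 * u x z t * w x z t + σ)) := fun x z t hy =>
        (((h.partialX x z t hy).mul (hwx x z t hy)).const_mul 2).add_const σ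
      refine this.congr h.isOpen (fun x z t hy => ?_) AgreeOn.rfl
      rw [hwx.dx_eq x z t hy]
      ring
    have hwxz : PartialZ D (dx w) fun x z t => 2 * (uz x z t * w x z t
        + u x z t * dz w x z t) := by
      have : PartialZ D (fun x z t => 2 * (u x z t * w x z t) + σ) fun x z t =>
          2 * (uz x z t * w x z t + u x z t * dz w x z t) := fun x z t hy =>
        (((h.partialZ x z t hy).mul (hwz x z t hy)).const_mul 2).add_const σ
      refine this.congr h.isOpen (fun x z t hy => ?_) AgreeOn.rfl
      rw [hwx.dx_eq x z t hy]
      ring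
    have hwxxz : PartialZ D (dx (dx w)) fun x z t =>
        2 * ((V x z t * w x z t + ux x z t * dz w x z t)
          + (uz x z t * dx w x z t
            + u x z t * (2 * (uz x z t * w x z t + u x z t * dz w x z t)))) := by
      have : PartialZ D (fun x z t => 2 * (ux x z t * w x z t + u x z t * dx w x z t)) _ :=
        fun x z t hy => (((h.partialZ_ux x z t hy).mul (hwz x z t hy)).add
          ((h.partialZ x z t hy).mul (hwxz x z t hy))).const_mul 2
      refine this.congr h.isOpen (fun x z t hy => ?_) AgreeOn.rfl
      simp only [hwxx.dx_eq x z t hy, hwx.dx_eq x z t hy]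
    have w0 := hw0 x z t hy
    simp only [hwt.dt_eq x z t hy, hwxxz.dz_eq x z t hy, hwxx.dx_eq x z t hy,
      hwxz.dz_eq x z t hy, hwx.dx_eq x z t hy, hinvz.dz_eq x z t hy]
    have e1 := h.flow x z t hy
    have e2 := hb x z t hy
    field_simp
    linear_combination (32 * w x z t ^ 3) * e1 + (32 * σ * w x z t ^ 2) * e2
      + (16 * dz w x z t) * hσ

end Abstract

end CKdV
end

noncomputable section

namespace CKdV

open Matrix

/-! ### The soliton data satisfy the abstract equations -/

section Soliton

variable {N : ℕ}

theorem transpose_res (p : Fin N → ℂ) (ε : ℂ) (l : Fin N → ℂ) : (res p ε l)ᵀ = res p ε l := by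
  have : (cauchy p l)ᵀ = cauchy p l := by
    ext i j
    simp only [transpose_apply, cauchy, add_comm (p j) (p i)]
    ring
  rw [res, transpose_nonsing_inv, transpose_add, transpose_one, transpose_smul, this]

/-- K, X and the diagonal matrix are symmetric, so transposition reverses the word. -/
theorem trace_rankOne_mul_comm (p : Fin N → ℂ) (ε : ℂ) (l d : Fin N → ℂ) :
    (rankOne p l * res p ε l * diagonal d).trace
      = (diagonal d * res p ε l * rankOne p l).trace := by
  rw [← trace_transpose, transpose_mul, transpose_mul, transpose_res, diagonal_transpose,
    rankOne, transpose_vecMulVec, mul_assoc]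

theorem det_one_sub_mul_vecMulVec (M M' : Matrix (Fin N) (Fin N) ℂ) (c : Fin N → ℂ) :
    (1 - M * vecMulVec c c * M').det = 1 - (M' * M * vecMulVec c c).trace := by
  rw [sub_eq_add_neg, mul_vecMulVec, vecMulVec_mul, ← neg_vecMulVec, vecMulVec_eq Unit,
    det_one_add_replicateCol_mul_replicateRow, dotProduct_neg, ← sub_eq_add_neg, trace_mul_comm,
    trace_vecMulVec_mul, ← mulVec_mulVec, ← dotProduct_mulVec]

variable {p : Fin N → ℂ} {l : Fin N → ℂ}

theorem diagonal_mul_inv (hp : ∀ j, p j ≠ 0) : diagonal p * diagonal p⁻¹ = 1 := by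
  rw [diagonal_mul_diagonal, ← diagonal_one]
  congr 1
  funext j
  exact mul_inv_cancel₀ (hp j)

theorem diagonal_inv_mul (hp : ∀ j, p j ≠ 0) : diagonal p⁻¹ * diagonal p = 1 := by
  rw [diagonal_mul_comm, diagonal_mul_inv hp]

/-- Conjugation by P gives P(1 - A)P⁻¹ = (1 + A)(1 - 2XKP⁻¹) by the Sylvester equation. The last
factor is a rank one perturbation of the identity, so its determinant is a trace. -/
theorem tau_neg_one (hp : ∀ j, p j ≠ 0) (hpp : ∀ j k, j ≠ k → p j + p k ≠ 0)
    (h : tau p 1 l ≠ 0) :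
    tau p (-1) l = tau p 1 l * (1 - 2 * (diagonal p⁻¹ * res p 1 l * rankOne p l).trace) := by
  set P := diagonal p
  set P' := diagonal p⁻¹
  set A := cauchy p l
  set K := rankOne p l
  set X := res p 1 l with hX
  have hPP' : P * P' = 1 := diagonal_mul_inv hp
  have hAX : (1 + A) * X = 1 := by
    have := mul_nonsing_inv (1 + (1 : ℂ) • A) (isUnit_iff_ne_zero.2 h)
    rw [one_smul] at this
    rw [hX, res, one_smul]
    exact this
  have e1 : P * (1 + (-1 : ℂ) • A) * P' = (1 + (1 : ℂ) • A) * (1 - X * K * (2 * P')) := by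
    have e2 : P * A = 2 * K - A * P := eq_sub_of_add_eq (sylvester hp hpp l)
    rw [one_smul, neg_one_smul]
    calc P * (1 + -A) * P' = P * P' - P * A * P' := by noncomm_ring
      _ = P * P' - 2 * K * P' + A * (P * P') := by rw [e2]; noncomm_ring
      _ = 1 + A - 1 * K * (2 * P') := by rw [hPP']; noncomm_ring
      _ = 1 + A - ((1 + A) * X) * K * (2 * P') := by rw [hAX]
      _ = _ := by noncomm_ring
  have e3 := congrArg det e1
  rw [det_mul, det_mul, mul_right_comm, ← det_mul, hPP', det_one, one_mul, det_mul] at e3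
  rw [tau, e3, tau]
  congr 1
  have := det_one_sub_mul_vecMulVec X (2 * P') (cvec p l)
  rw [show K = vecMulVec (cvec p l) (cvec p l) from rfl, this]
  congr 1
  rw [two_mul, add_mul, add_mul, trace_add, two_mul]

variable (p) (q s : Fin N → ℂ)

/-- The directions of the `t` flow. -/
def tDir : Fin N → ℂ := fun j => -(1 / 4) * p j ^ 2 * q j

theorem trRes₁_tDir (ε : ℂ) : trRes₁ p ε (tDir p q) l = -(1 / 4) * trRes₁ p ε (p * p * q) l := by
  have : diagonal (tDir p q) = (-(1 / 4) : ℂ) • diagonal (p * p * q) := by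
    rw [← diagonal_smul]
    congr 1
    funext j
    simp only [tDir, Pi.smul_apply, Pi.mul_apply, smul_eq_mul]
    ring
  simp only [trRes₁, this, mul_smul_comm, smul_mul, trace_smul, smul_eq_mul]

/-- `(log (f / g))_x`. -/
def uFun (x z t : ℝ) : ℂ := logDeriv (fun x' : ℝ => f p q s x' z t / g p q s x' z t) x

/-- `(log (f g))_xz`. -/
def CFun (x z t : ℝ) : ℂ :=
  (expSum p q s (fun S => (∑ i ∈ S, q i) * ((∑ i ∈ S, p i) * etaProd p S)) x z t * f p q s x z t
    - expSum p q s (fun S => (∑ i ∈ S, p i) * etaProd p S) x z t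
      * expSum p q s (fun S => (∑ i ∈ S, q i) * etaProd p S) x z t) / f p q s x z t ^ 2
  + (expSum p q s (fun S => (∑ i ∈ S, q i) * ((∑ i ∈ S, p i) * ((-1) ^ S.card * etaProd p S))) x z t
      * g p q s x z t
    - expSum p q s (fun S => (∑ i ∈ S, p i) * ((-1) ^ S.card * etaProd p S)) x z t
      * expSum p q s (fun S => (∑ i ∈ S, q i) * ((-1) ^ S.card * etaProd p S)) x z t)
    / g p q s x z t ^ 2

/-- `trRes₁` along the flows. -/
def tr₁ (ε : ℂ) (d : Fin N → ℂ) (x z t : ℝ) : ℂ := trRes₁ p ε d (lamVec p q s x z t)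

/-- `trRes₂` along the flows. -/
def tr₂ (ε : ℂ) (d e : Fin N → ℂ) (x z t : ℝ) : ℂ := trRes₂ p ε d e (lamVec p q s x z t)

/-- The trace of `P² Q (X - Y)`. -/
def flowTrace (x z t : ℝ) : ℂ :=
  (diagonal (p * p * q) * res p 1 (lamVec p q s x z t)).trace
    - (diagonal (p * p * q) * res p (-1) (lamVec p q s x z t)).trace

variable {p q s} (hp : ∀ j, p j ≠ 0) (hpp : ∀ j k, j ≠ k → p j + p k ≠ 0)

include hp hpp

theorem tau_ne_zero {x z t : ℝ} (h : (x, z, t) ∈ domV p q s) :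
    tau p 1 (lamVec p q s x z t) ≠ 0 ∧ tau p (-1) (lamVec p q s x z t) ≠ 0 := by
  have h1 := h.1
  have h2 := h.2
  simp only [f_eq_tau hp hpp] at h1
  simp only [g_eq_tau hp hpp] at h2
  exact ⟨h1, h2⟩

theorem f_log_x {x z t : ℝ} (h : (x, z, t) ∈ domV p q s) :
    HasDerivAt (fun x' => f p q s x' z t)
      (f p q s x z t * trRes p 1 (lamVec p q s x z t)) x := by
  have h1 := (tau_ne_zero hp hpp h).1
  have := tau_deriv (ε := 1) (ℓ := fun x' => lamVec p q s x' z t)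
    (fun j => lam_hasDerivAt_x p q s j x z t) h1
  rw [← trRes_eq hp hpp h1, one_mul] at this
  simp only [f_eq_tau hp hpp]
  exact this

theorem g_log_x {x z t : ℝ} (h : (x, z, t) ∈ domV p q s) :
    HasDerivAt (fun x' => g p q s x' z t)
      (g p q s x z t * -trRes p (-1) (lamVec p q s x z t)) x := by
  have h1 := (tau_ne_zero hp hpp h).2
  have := tau_deriv (ε := -1) (ℓ := fun x' => lamVec p q s x' z t)
    (fun j => lam_hasDerivAt_x p q s j x z t) h1
  rw [← trRes_eq hp hpp h1, neg_one_mul] at this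
  simp only [g_eq_tau hp hpp]
  exact this

/-- A bridge between two descriptions: exponential sums carry smoothness and asymptotics, traces
carry the identities. Uniqueness of derivatives equates them. -/
theorem expSum_f_x {x z t : ℝ} (h : (x, z, t) ∈ domV p q s) :
    expSum p q s (fun S => (∑ i ∈ S, p i) * etaProd p S) x z t
      = f p q s x z t * trRes p 1 (lamVec p q s x z t) := by
  have h1 := f_log_x hp hpp h
  rw [f_eq_expSum] at h1 ⊢
  exact (expSum_hasDerivAt_x p q s _ x z t).unique h1

theorem expSum_g_x {x z t : ℝ} (h : (x, z, t) ∈ domV p q s) :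
    expSum p q s (fun S => (∑ i ∈ S, p i) * ((-1) ^ S.card * etaProd p S)) x z t
      = g p q s x z t * -trRes p (-1) (lamVec p q s x z t) := by
  have h1 := g_log_x hp hpp h
  rw [g_eq_expSum] at h1 ⊢
  exact (expSum_hasDerivAt_x p q s _ x z t).unique h1

theorem quotient_x {x z t : ℝ} (h : (x, z, t) ∈ domV p q s) :
    HasDerivAt (fun x' => f p q s x' z t / g p q s x' z t)
      ((trRes p 1 (lamVec p q s x z t) + trRes p (-1) (lamVec p q s x z t))
        * (f p q s x z t / g p q s x z t)) x := by
  refine ((f_log_x hp hpp h).div (g_log_x hp hpp h) h.2).congr_deriv ?_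
  have h2 : g p q s x z t ≠ 0 := h.2
  field_simp
  ring

theorem uFun_eq {x z t : ℝ} (h : (x, z, t) ∈ domV p q s) : uFun p q s x z t
      = trRes p 1 (lamVec p q s x z t) + trRes p (-1) (lamVec p q s x z t) := by
  have h1 : f p q s x z t ≠ 0 := h.1
  have h2 : g p q s x z t ≠ 0 := h.2
  rw [uFun, logDeriv_apply, (quotient_x hp hpp h).deriv, mul_div_cancel_right₀ _ (div_ne_zero h1 h2)]

theorem quotient_partialX : PartialX (domV p q s) (fun x z t => f p q s x z t / g p q s x z t)
    fun x z t => uFun p q s x z t * (f p q s x z t / g p q s x z t) := fun x z t h => by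
  simp only [uFun_eq hp hpp h]
  exact quotient_x hp hpp h

theorem quotient_partialT : PartialT (domV p q s) (fun x z t => f p q s x z t / g p q s x z t)
    fun x z t => flowTrace p q s x z t / 4 * (f p q s x z t / g p q s x z t) := fun x z t h => by
  have h0 := tau_ne_zero hp hpp h
  have h1 := tau_deriv (ε := 1) (ℓ := fun t' => lamVec p q s x z t')
    (fun j => lam_hasDerivAt_t p q s j x z t) h0.1
  have h2 := tau_deriv (ε := -1) (ℓ := fun t' => lamVec p q s x z t')
    (fun j => lam_hasDerivAt_t p q s j x z t) h0.2
  have h3 := h1.fun_div h2 h0.2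
  simp only [f_eq_tau hp hpp, g_eq_tau hp hpp]
  refine h3.congr_deriv ?_
  have e1 : diagonal (fun j => -(1 / 4) * p j ^ 2 * q j)
      = (-(1 / 4) : ℂ) • diagonal (p * p * q) := by
    rw [← diagonal_smul]
    congr 1
    funext j
    simp only [Pi.smul_apply, Pi.mul_apply, smul_eq_mul]
    ring
  rw [e1, flowTrace]
  simp only [smul_mul, trace_smul, smul_eq_mul, mul_sub, trace_sub]
  have h4 := h0.2
  field_simp
  ring

/-- `CFun` is defined by the quotient rule on exponential sums, from which its decay can be read
off. This is the trace form on which the identities act. -/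
theorem CFun_eq {x z t : ℝ} (h : (x, z, t) ∈ domV p q s) :
    CFun p q s x z t = tr₁ p q s 1 q x z t - tr₁ p q s (-1) q x z t := by
  have hD := isOpen_domV p q s
  have h0 := tau_ne_zero hp hpp h
  have h1 : f p q s x z t ≠ 0 := h.1
  have h2 : g p q s x z t ≠ 0 := h.2
  have d1 := trRes_deriv (ε := 1) (ℓ := fun z' => lamVec p q s x z' t)
    (fun j => lam_hasDerivAt_z p q s j x z t) h0.1
  have d2 := trRes_deriv (ε := -1) (ℓ := fun z' => lamVec p q s x z' t)
    (fun j => lam_hasDerivAt_z p q s j x z t) h0.2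
  have a1 := expSum_hasDerivAt_z p q s (etaProd p) x z t
  have a2 := expSum_hasDerivAt_z p q s (fun S => (-1) ^ S.card * etaProd p S) x z t
  rw [← f_eq_expSum] at a1
  rw [← g_eq_expSum] at a2
  have b1 := (expSum_hasDerivAt_z p q s (fun S => (∑ i ∈ S, p i) * etaProd p S) x z t).fun_div
    a1 h1
  have b2 := (expSum_hasDerivAt_z p q s
    (fun S => (∑ i ∈ S, p i) * ((-1) ^ S.card * etaProd p S)) x z t).fun_div a2 h2
  have c1 := b1.unique (d1.congr_of_eventuallyEq
    ((eventually_mem_z hD h).mono fun z' hz => by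
      simp only [expSum_f_x hp hpp hz]; exact mul_div_cancel_left₀ _ hz.1))
  have c2 := b2.unique (d2.neg.congr_of_eventuallyEq
    ((eventually_mem_z hD h).mono fun z' hz => by
      simp only [expSum_g_x hp hpp hz]; exact mul_div_cancel_left₀ _ hz.2))
  rw [CFun, c1, c2]
  rfl

theorem uFun_smoothOn : SmoothOn (domV p q s) (uFun p q s) := by
  have hf := expSum_smoothOn p q s (domV p q s) (etaProd p)
  have hg := expSum_smoothOn p q s (domV p q s) fun S => (-1) ^ S.card * etaProd p S
  have hf' := expSum_smoothOn p q s (domV p q s) fun S => (∑ i ∈ S, p i) * etaProd p S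
  have hg' := expSum_smoothOn p q s (domV p q s)
    fun S => (∑ i ∈ S, p i) * ((-1) ^ S.card * etaProd p S)
  rw [← f_eq_expSum] at hf
  rw [← g_eq_expSum] at hg
  have h1 : SmoothOn (domV p q s) fun x z t =>
      expSum p q s (fun S => (∑ i ∈ S, p i) * etaProd p S) x z t * (f p q s x z t)⁻¹
        - expSum p q s (fun S => (∑ i ∈ S, p i) * ((-1) ^ S.card * etaProd p S)) x z t
          * (g p q s x z t)⁻¹ :=
    (ContDiffOn.mul hf' (ContDiffOn.inv hf fun y hy => hy.1)).sub
      (ContDiffOn.mul hg' (ContDiffOn.inv hg fun y hy => hy.2))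
  refine h1.congr fun x z t h => ?_
  have h3 : f p q s x z t ≠ 0 := h.1
  have h4 : g p q s x z t ≠ 0 := h.2
  simp only [uFun_eq hp hpp h, expSum_f_x hp hpp h, expSum_g_x hp hpp h]
  field_simp
  ring

theorem flowData : FlowData (domV p q s) (uFun p q s)
    (fun x z t => tr₁ p q s 1 p x z t + tr₁ p q s (-1) p x z t)
    (fun x z t => tr₁ p q s 1 q x z t + tr₁ p q s (-1) q x z t)
    (fun x z t => tr₁ p q s 1 (tDir p q) x z t + tr₁ p q s (-1) (tDir p q) x z t)
    (CFun p q s)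
    (fun x z t => tr₂ p q s 1 p q x z t + tr₂ p q s (-1) p q x z t)
    (fun x z t => tr₂ p q s 1 p q x z t - tr₂ p q s (-1) p q x z t)
    (flowTrace p q s) := by
  have hD := isOpen_domV p q s
  have hu : AgreeOn (domV p q s) (uFun p q s) fun x z t =>
      trRes p 1 (lamVec p q s x z t) + trRes p (-1) (lamVec p q s x z t) :=
    fun x z t h => uFun_eq hp hpp h
  have hx : ∀ x z t : ℝ, ∀ j, HasDerivAt (fun x' => lamVec p q s x' z t j) (p j) x :=
    fun x z t j => lam_hasDerivAt_x p q s j x z t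
  have hz : ∀ x z t : ℝ, ∀ j, HasDerivAt (fun z' => lamVec p q s x z' t j) (q j) z :=
    fun x z t j => lam_hasDerivAt_z p q s j x z t
  have ht : ∀ x z t : ℝ, ∀ j, HasDerivAt (fun t' => lamVec p q s x z t' j) (tDir p q j) t :=
    fun x z t j => lam_hasDerivAt_t p q s j x z t
  have h0 : ∀ {x z t : ℝ}, (x, z, t) ∈ domV p q s → _ := fun h => tau_ne_zero hp hpp h
  refine ⟨hD, uFun_smoothOn hp hpp, ?_, ?_, ?_, ?_, ?_, ?_, ?_, ?_⟩
  · exact PartialX.congr (fun x z t h => (trRes_deriv (hx x z t) (h0 h).1).fun_add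
      (trRes_deriv (hx x z t) (h0 h).2)) hD hu AgreeOn.rfl
  · exact PartialZ.congr (fun x z t h => (trRes_deriv (hz x z t) (h0 h).1).fun_add
      (trRes_deriv (hz x z t) (h0 h).2)) hD hu AgreeOn.rfl
  · exact PartialT.congr (fun x z t h => (trRes_deriv (ht x z t) (h0 h).1).fun_add
      (trRes_deriv (ht x z t) (h0 h).2)) hD hu AgreeOn.rfl
  · exact fun x z t h => (trRes₁_deriv p (hz x z t) (h0 h).1).fun_add
      (trRes₁_deriv p (hz x z t) (h0 h).2)
  · intro x z t h
    refine ((trace_diagonal_mul_res_deriv hp hpp (p * p * q) (hx x z t) (h0 h).1).fun_sub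
      (trace_diagonal_mul_res_deriv hp hpp (p * p * q) (hx x z t) (h0 h).2)).congr_deriv ?_
    simp only [tr₁, trRes₁_tDir]
    ring
  · refine PartialX.congr (fun x z t h => (trRes₁_deriv q (hx x z t) (h0 h).1).fun_sub
      (trRes₁_deriv q (hx x z t) (h0 h).2)) hD (fun x z t h => CFun_eq hp hpp h)
      (fun x z t h => ?_)
    simp only [tr₂, trRes₂_comm p _ p q]
  · intro x z t h
    have := (relations hp hpp q (h0 h).1 (h0 h).2).flow_identity
    rw [CFun_eq hp hpp h, uFun_eq hp hpp h]
    have e1 : diagonal (p * p * q) = diagonal p * diagonal p * diagonal q := by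
      rw [diagonal_mul_diagonal, diagonal_mul_diagonal]
      rfl
    simp only [flowTrace, tr₂, tr₁, trRes₂, trRes₁, trRes, e1]
    rw [← this]
    ring
  -- The identity (log fg)_xx = -u² holds on an open set, so it may be differentiated in z.
  · have hm : AgreeOn (domV p q s) (fun x z t => tr₁ p q s 1 p x z t - tr₁ p q s (-1) p x z t)
        fun x z t => -uFun p q s x z t ^ 2 := fun x z t h => by
      have := (relations hp hpp q (h0 h).1 (h0 h).2).miura_identity
      simp only [uFun_eq hp hpp h]
      exact eq_neg_of_add_eq_zero_left this
    intro x z t h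
    have h1 : PartialZ (domV p q s) (fun x z t => tr₁ p q s 1 p x z t - tr₁ p q s (-1) p x z t) _ :=
      fun x z t h => (trRes₁_deriv p (hz x z t) (h0 h).1).fun_sub
        (trRes₁_deriv p (hz x z t) (h0 h).2)
    have h2 : HasDerivAt (fun z' => uFun p q s x z' t)
        (tr₁ p q s 1 q x z t + tr₁ p q s (-1) q x z t) z :=
      PartialZ.congr (fun x z t h => (trRes_deriv (hz x z t) (h0 h).1).fun_add
        (trRes_deriv (hz x z t) (h0 h).2)) hD hu AgreeOn.rfl x z t h
    have h3 := (h2.fun_pow 2).neg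
    have h4 := (h1.congr hD hm.symm AgreeOn.rfl x z t h).unique h3
    norm_num at h4
    simp only [tr₂]
    rw [h4]
    ring

/-- `g / f = 1 - 2 tr (P⁻¹ X K)`. -/
theorem quotient_inv {x z t : ℝ} (h : (x, z, t) ∈ domV p q s) :
    1 - 2 * (diagonal p⁻¹ * res p 1 (lamVec p q s x z t) * rankOne p (lamVec p q s x z t)).trace
      = (f p q s x z t / g p q s x z t)⁻¹ := by
  have h1 := (tau_ne_zero hp hpp h).1
  have := tau_neg_one hp hpp h1
  rw [inv_div, f_eq_tau hp hpp, g_eq_tau hp hpp]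
  rw [this, mul_div_cancel_left₀ _ h1]

/-- The derivative of x + 4 tr P⁻¹X is 1 - 4 tr P⁻¹XKX, which `square_identity` recognises as (1 - 2
tr P⁻¹XK)² = (g/f)². -/
theorem Phi_partialX : PartialX (domV p q s) (Phi p q s)
    fun x z t => (f p q s x z t / g p q s x z t) ^ (-2 : ℤ) := fun x z t h => by
  have h0 := tau_ne_zero hp hpp h
  have h1 := (EntryDeriv.const_mul (diagonal p⁻¹) (res_deriv_self hp hpp
    (ℓ := fun x' => lamVec p q s x' z t) (fun j => lam_hasDerivAt_x p q s j x z t) h0.1)).trace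
  have h2 := (Complex.ofRealCLM.hasDerivAt (x := x)).fun_add (h1.const_mul 4)
  have h3 := (relations hp hpp q h0.1 h0.2).square_identity (diagonal_mul_inv hp)
    (diagonal_inv_mul hp) (trace_rankOne_mul_comm p 1 _ _)
  rw [quotient_inv hp hpp h] at h3
  simp only [Phi_eq hp hpp]
  refine h2.congr_deriv ?_
  rw [_root_.zpow_neg, zpow_ofNat, ← inv_pow, h3]
  simp only [one_smul, mul_neg, trace_neg, ← mul_assoc, Complex.ofRealCLM_apply, Complex.ofReal_one]
  ring

theorem Phi_partialT : PartialT (domV p q s) (Phi p q s)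
    fun x z t => (f p q s x z t / g p q s x z t)⁻¹ ^ 2 * tr₁ p q s (-1) q x z t :=
  fun x z t h => by
  have h0 := tau_ne_zero hp hpp h
  have h1 := (EntryDeriv.const_mul (diagonal p⁻¹) (res_deriv
    (ℓ := fun t' => lamVec p q s x z t') (fun j => lam_hasDerivAt_t p q s j x z t) h0.1)).trace
  have h2 := (h1.const_mul 4).const_add (x : ℂ)
  have h3 := (relations hp hpp q h0.1 h0.2).flow_potential_identity (diagonal_mul_inv hp)
    (diagonal_inv_mul hp) (trace_rankOne_mul_comm p 1 _ _)
  rw [quotient_inv hp hpp h] at h3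
  simp only [Phi_eq hp hpp]
  refine h2.congr_deriv ?_
  simp only [tr₁, trRes₁]
  rw [h3]
  have e1 : diagonal (fun j => -(1 / 4) * p j ^ 2 * q j)
      = (-(1 / 4) : ℂ) • (diagonal p * diagonal p * diagonal q) := by
    rw [diagonal_mul_diagonal, diagonal_mul_diagonal, ← diagonal_smul]
    congr 1
    funext j
    simp only [Pi.smul_apply, smul_eq_mul]
    ring
  rw [e1]
  simp only [smul_mul, mul_smul_comm, trace_smul, smul_eq_mul, mul_sub, mul_add, trace_sub,
    trace_add, mul_assoc]
  ring

end Soliton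

end CKdV
end

noncomputable section

namespace CKdV

open Matrix

/-! ### Primitives on open subsets of the line -/

section Primitive

open MeasureTheory Set Filter

/-- A continuous function on an open subset of the line has a primitive there; the primitive can be
chosen to vanish at `-∞` when the function decays fast enough. -/
theorem exists_primitive {U : Set ℝ} (hU : IsOpen U) {h : ℝ → ℂ} (hc : ContinuousOn h U) :
    ∃ A : ℝ → ℂ, (∀ x ∈ U, HasDerivAt A (h x) x) ∧
      ((∀ᶠ x in atBot, x ∈ U) → (h =O[atBot] fun x : ℝ => (1 + x ^ 2)⁻¹) →
        Tendsto A atBot (𝓝 0)) := by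
  classical
  -- U may be disconnected, so each component gets its own base point.
  let A₀ : ℝ → ℂ := fun x => if hx : x ∈ U then ∫ y in (ordConnectedProj U ⟨x, hx⟩)..x, h y else 0
  have hint : ∀ a b, uIcc a b ⊆ U → IntervalIntegrable h volume a b := fun a b hab =>
    (hc.mono hab).intervalIntegrable
  have hproj : ∀ a (ha : a ∈ U) b (hb : b ∈ U), uIcc a b ⊆ U →
      A₀ b = ∫ y in (ordConnectedProj U ⟨a, ha⟩)..b, h y := by
    intro a ha b hb hab
    have : ordConnectedProj U ⟨a, ha⟩ = ordConnectedProj U ⟨b, hb⟩ := ordConnectedProj_eq.2 hab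
    simp only [A₀, dif_pos hb, this]
  have hbase : ∀ a (ha : a ∈ U), uIcc (ordConnectedProj U ⟨a, ha⟩) a ⊆ U := fun a ha =>
    mem_ordConnectedComponent.1 (mem_ordConnectedComponent_ordConnectedProj U ⟨a, ha⟩)
  have hA₀ : ∀ x ∈ U, HasDerivAt A₀ (h x) x := by
    intro x hx
    have h1 := intervalIntegral.integral_hasDerivAt_right (hint _ _ (hbase x hx))
      (hc.stronglyMeasurableAtFilter hU x hx) (hc.continuousAt (hU.mem_nhds hx))
    refine h1.congr_of_eventuallyEq ?_
    filter_upwards [ordConnectedComponent_mem_nhds.2 (hU.mem_nhds hx)] with y hy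
    have hy' := mem_ordConnectedComponent.1 hy
    exact hproj x hx y (hy' right_mem_uIcc) hy'
  -- The primitive must be fixed before any decay is known. The limit is therefore subtracted
  -- whenever it exists, and decay is used only to exclude the other case.
  by_cases hlim : ∃ L, Tendsto A₀ atBot (𝓝 L)
  · obtain ⟨L, hL⟩ := hlim
    refine ⟨fun x => A₀ x - L, fun x hx => (hA₀ x hx).sub_const L, fun _ _ => ?_⟩
    simpa using hL.sub_const L
  · refine ⟨A₀, hA₀, fun hev hO => (hlim ?_).elim⟩
    obtain ⟨a₁, ha₁⟩ := eventually_atBot.1 hev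
    have hm : StronglyMeasurableAtFilter h atBot := by
      refine ⟨Iic a₁, Iic_mem_atBot a₁, ?_⟩
      exact (hc.mono fun x hx => ha₁ x hx).aestronglyMeasurable measurableSet_Iic
    obtain ⟨T, hT, hTi⟩ := hO.integrableAtFilter hm
      (integrable_inv_one_add_sq.integrableAtFilter atBot)
    obtain ⟨a₂, ha₂⟩ := mem_atBot_sets.1 hT
    set a := min a₁ a₂
    have haU : a ∈ U := ha₁ a (min_le_left _ _)
    have hIic : ∀ x ≤ a, x ∈ U := fun x hx => ha₁ x (hx.trans (min_le_left _ _))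
    have hi : IntegrableOn h (Iic a) :=
      hTi.mono_set fun x hx => ha₂ x (le_trans hx (min_le_right _ _))
    have h1 := intervalIntegral_tendsto_integral_Iic a hi tendsto_id
    refine ⟨(∫ y in (ordConnectedProj U ⟨a, haU⟩)..a, h y) - ∫ y in Iic a, h y, ?_⟩
    refine (h1.const_sub _).congr' ?_
    filter_upwards [eventually_le_atBot a] with x hx
    have hax : uIcc a x ⊆ U := by
      rw [uIcc_of_ge hx]
      exact fun y hy => hIic y hy.2
    rw [hproj a haU x (hIic x hx) hax, id, sub_eq_iff_eq_add,
      intervalIntegral.integral_add_adjacent_intervals]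
    · have := hint _ _ (hbase a haU)
      exact this.trans (hint _ _ hax)
    · exact hint _ _ (by rwa [uIcc_comm])

end Primitive

/-! ### Asymptotics of sums of exponentials -/

section Asymptotics

open Filter

theorem tendsto_ofReal_inv_atBot : Tendsto (fun x : ℝ => (x : ℂ)⁻¹) atBot (𝓝 0) := by
  have := (Complex.continuous_ofReal.tendsto 0).comp (tendsto_inv_atBot_zero (𝕜 := ℝ))
  simpa [Function.comp_def] using this

theorem tendsto_mul_exp_atBot {δ : ℂ} (hδ : 0 < δ.re) (κ : ℂ) :
    Tendsto (fun x : ℝ => (x : ℂ) * Complex.exp (δ * x + κ)) atBot (𝓝 0) := by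
  rw [tendsto_zero_iff_norm_tendsto_zero]
  have h1 := (Real.tendsto_pow_mul_exp_neg_atTop_nhds_zero 1).comp
    ((tendsto_neg_atBot_atTop (G := ℝ)).const_mul_atTop hδ)
  have h2 := h1.const_mul (δ.re⁻¹ * Real.exp κ.re)
  rw [mul_zero] at h2
  refine h2.congr' ?_
  filter_upwards [eventually_le_atBot 0] with x hx
  rw [norm_mul, Complex.norm_real, Complex.norm_exp, Real.norm_of_nonpos hx]
  simp only [Function.comp_apply, pow_one, Complex.add_re, Complex.mul_re, Complex.ofReal_re,
    Complex.ofReal_im, mul_zero, sub_zero, Real.exp_add]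
  rw [show -(δ.re * -x) = δ.re * x by ring]
  field_simp

theorem tendsto_exp_atBot {δ : ℂ} (hδ : 0 < δ.re) (κ : ℂ) :
    Tendsto (fun x : ℝ => Complex.exp (δ * x + κ)) atBot (𝓝 0) := by
  have := tendsto_ofReal_inv_atBot.mul (tendsto_mul_exp_atBot hδ κ)
  rw [zero_mul] at this
  refine this.congr' ?_
  filter_upwards [eventually_lt_atBot 0] with x hx
  have : (x : ℂ) ≠ 0 := by exact_mod_cast hx.ne
  field_simp

variable {N : ℕ} (p q s : Fin N → ℂ)

/-- The index set of the exponential that dominates as `x → -∞`. -/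
def domSet : Finset (Fin N) := Finset.univ.filter fun j => (p j).re < 0

/-- The dominating exponential as `x → -∞`. -/
def domExp (x z t : ℝ) : ℂ := Complex.exp (∑ i ∈ domSet p, lam p q s i x z t)

variable {p}

/-- The real part of a subset sum is least when exactly the negative terms are collected; the
minimiser is unique because no real part vanishes. -/
theorem re_domSet_lt (hre : ∀ j, (p j).re ≠ 0) {S : Finset (Fin N)} (hS : S ≠ domSet p) :
    0 < (∑ i ∈ S, p i - ∑ i ∈ domSet p, p i).re := by
  rw [Complex.sub_re, Complex.re_sum, Complex.re_sum, sub_pos]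
  have hsum : ∀ T : Finset (Fin N),
      ∑ i ∈ T, (p i).re = ∑ i, if i ∈ T then (p i).re else 0 := fun T => by simp
  rw [hsum, hsum S]
  have hmem : ∀ i, i ∈ domSet p ↔ (p i).re < 0 := fun i => by simp [domSet]
  have hle : ∀ i, (if i ∈ domSet p then (p i).re else 0) ≤ if i ∈ S then (p i).re else 0 := by
    intro i
    by_cases h1 : (p i).re < 0
    · rw [if_pos ((hmem i).2 h1)]
      split_ifs
      exacts [le_rfl, h1.le]
    · rw [if_neg (fun h => h1 ((hmem i).1 h))]
      split_ifs
      exacts [not_lt.1 h1, le_rfl]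
  refine Finset.sum_lt_sum (fun i _ => hle i) ?_
  by_contra hcon
  push Not at hcon
  refine hS (Finset.ext fun i => ?_)
  have h1 := hcon i (Finset.mem_univ i)
  by_cases h2 : i ∈ S <;> by_cases h3 : i ∈ domSet p
  · simp [h2, h3]
  · rw [if_pos h2, if_neg h3] at h1
    exact (h3 ((hmem i).2 (lt_of_le_of_ne h1 (hre i)))).elim
  · rw [if_neg h2, if_pos h3] at h1
    exact (not_lt.2 h1 ((hmem i).1 h3)).elim
  · simp [h2, h3]

variable {q s}

theorem expSum_div_domExp (a : Finset (Fin N) → ℂ) (x z t : ℝ) :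
    expSum p q s a x z t / domExp p q s x z t = ∑ S : Finset (Fin N), a S *
      Complex.exp ((∑ i ∈ S, p i - ∑ i ∈ domSet p, p i) * x
        + (∑ i ∈ S, lam p q s i 0 z t - ∑ i ∈ domSet p, lam p q s i 0 z t)) := by
  have hlam : ∀ T : Finset (Fin N), ∑ i ∈ T, lam p q s i x z t
      = (∑ i ∈ T, p i) * x + ∑ i ∈ T, lam p q s i 0 z t := fun T => by
    rw [Finset.sum_mul, ← Finset.sum_add_distrib]
    refine Finset.sum_congr rfl fun i _ => ?_
    simp only [lam, Complex.ofReal_zero]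
    ring
  rw [expSum, domExp, Finset.sum_div]
  refine Finset.sum_congr rfl fun S _ => ?_
  rw [mul_div_assoc, ← Complex.exp_sub, hlam S, hlam (domSet p)]
  congr 2
  ring

variable (hre : ∀ j, (p j).re ≠ 0)

include hre

theorem tendsto_expSum_div (a : Finset (Fin N) → ℂ) (z t : ℝ) :
    Tendsto (fun x : ℝ => expSum p q s a x z t / domExp p q s x z t) atBot
      (𝓝 (a (domSet p))) := by
  simp only [expSum_div_domExp]
  have h : ∀ S, Tendsto (fun x : ℝ => a S *
      Complex.exp ((∑ i ∈ S, p i - ∑ i ∈ domSet p, p i) * x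
        + (∑ i ∈ S, lam p q s i 0 z t - ∑ i ∈ domSet p, lam p q s i 0 z t))) atBot
      (𝓝 (if S = domSet p then a S else 0)) := by
    intro S
    split_ifs with hS
    · subst hS
      simp
    · simpa using (tendsto_exp_atBot (re_domSet_lt hre hS) _).const_mul (a S)
  simpa using tendsto_finsetSum Finset.univ fun S _ => h S

/-- Without the dominant term only exponentially small ones remain, and they beat the factor x. -/
theorem tendsto_mul_expSum_div {a : Finset (Fin N) → ℂ} (ha : a (domSet p) = 0) (z t : ℝ) :
    Tendsto (fun x : ℝ => x * (expSum p q s a x z t / domExp p q s x z t)) atBot (𝓝 0) := by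
  simp only [expSum_div_domExp, Finset.mul_sum]
  have h : ∀ S, Tendsto (fun x : ℝ => (x : ℂ) * (a S *
      Complex.exp ((∑ i ∈ S, p i - ∑ i ∈ domSet p, p i) * x
        + (∑ i ∈ S, lam p q s i 0 z t - ∑ i ∈ domSet p, lam p q s i 0 z t)))) atBot
      (𝓝 0) := by
    intro S
    by_cases hS : S = domSet p
    · subst hS
      simp [ha]
    · have := (tendsto_mul_exp_atBot (re_domSet_lt hre hS)
        (∑ i ∈ S, lam p q s i 0 z t - ∑ i ∈ domSet p, lam p q s i 0 z t)).const_mul (a S)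
      rw [mul_zero] at this
      refine this.congr fun x => ?_
      ring
  simpa using tendsto_finsetSum Finset.univ fun S _ => h S

theorem eventually_expSum_ne_zero {a : Finset (Fin N) → ℂ} (ha : a (domSet p) ≠ 0) (z t : ℝ) :
    ∀ᶠ x : ℝ in atBot, expSum p q s a x z t ≠ 0 :=
  ((tendsto_expSum_div hre a z t).eventually_ne ha).mono fun x hx h => hx (by rw [h, zero_div])

/-- Quotients of sums of exponentials. -/
theorem tendsto_quotient (a : Finset (Fin N) → ℂ) {b : Finset (Fin N) → ℂ}
    (hb : b (domSet p) ≠ 0) (z t : ℝ) :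
    Tendsto (fun x : ℝ => expSum p q s a x z t / expSum p q s b x z t) atBot
      (𝓝 (a (domSet p) / b (domSet p))) := by
  refine ((tendsto_expSum_div (q := q) (s := s) hre a z t).div
    (tendsto_expSum_div (q := q) (s := s) hre b z t) hb).congr fun x => ?_
  exact div_div_div_cancel_right₀ (Complex.exp_ne_zero _) _ _

/-- The `z` derivative of a quotient of sums of exponentials is `o(1 / x)`. -/
theorem tendsto_mul_quotient_z (a : Finset (Fin N) → ℂ) {b : Finset (Fin N) → ℂ}
    (hb : b (domSet p) ≠ 0) (z t : ℝ) :
    Tendsto (fun x : ℝ => x *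
      ((expSum p q s (fun S => (∑ i ∈ S, q i) * a S) x z t * expSum p q s b x z t
        - expSum p q s a x z t * expSum p q s (fun S => (∑ i ∈ S, q i) * b S) x z t)
          / expSum p q s b x z t ^ 2)) atBot (𝓝 0) := by
  -- Shifting every z-frequency by q₀ leaves the numerator of the quotient rule unchanged and kills
  -- the dominant coefficient of both z-derivatives.
  set q₀ := ∑ i ∈ domSet p, q i with hq₀
  have key : ∀ (a : Finset (Fin N) → ℂ) (x : ℝ),
      expSum p q s (fun S => (∑ i ∈ S, q i - q₀) * a S) x z t
        = expSum p q s (fun S => (∑ i ∈ S, q i) * a S) x z t - q₀ * expSum p q s a x z t := by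
    intro a x
    simp only [expSum, Finset.mul_sum, ← Finset.sum_sub_distrib]
    exact Finset.sum_congr rfl fun S _ => by ring
  have h1 := tendsto_mul_expSum_div (q := q) (s := s) hre
    (a := fun S => (∑ i ∈ S, q i - q₀) * a S) (by simp [hq₀]) z t
  have h2 := tendsto_mul_expSum_div (q := q) (s := s) hre
    (a := fun S => (∑ i ∈ S, q i - q₀) * b S) (by simp [hq₀]) z t
  have h3 := tendsto_expSum_div (q := q) (s := s) hre a z t
  have h4 := tendsto_expSum_div (q := q) (s := s) hre b z t
  have h5 := ((h1.mul h4).sub (h3.mul h2)).div (h4.pow 2) (pow_ne_zero 2 hb)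
  simp only [zero_mul, mul_zero, sub_zero, zero_div] at h5
  refine h5.congr' ?_
  filter_upwards [eventually_expSum_ne_zero (q := q) (s := s) hre hb z t] with x hx
  have hE : domExp p q s x z t ≠ 0 := Complex.exp_ne_zero _
  simp only [key, Pi.div_apply]
  field_simp
  ring

theorem tendsto_log_xz {a : Finset (Fin N) → ℂ} (ha : a (domSet p) ≠ 0) (z t : ℝ) :
    Tendsto (fun x : ℝ =>
      (expSum p q s (fun S => (∑ i ∈ S, q i) * ((∑ i ∈ S, p i) * a S)) x z t
          * expSum p q s a x z t
        - expSum p q s (fun S => (∑ i ∈ S, p i) * a S) x z t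
          * expSum p q s (fun S => (∑ i ∈ S, q i) * a S) x z t) / expSum p q s a x z t ^ 2)
      atBot (𝓝 0) := by
  have h1 := tendsto_mul_quotient_z (q := q) (s := s) hre (fun S => (∑ i ∈ S, p i) * a S) ha z t
  have h2 := tendsto_ofReal_inv_atBot.mul h1
  rw [mul_zero] at h2
  refine h2.congr' ?_
  filter_upwards [eventually_lt_atBot 0] with x hx
  have : (x : ℂ) ≠ 0 := by exact_mod_cast hx.ne
  rw [inv_mul_cancel_left₀ this]

end Asymptotics

end CKdV
end

noncomputable section

namespace CKdV

open Matrix Filter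

/-! ### The Calogero-KdV solution -/

section Solution

variable {N : ℕ} {p q s : Fin N → ℂ}

theorem f_smoothOn (D : Set (ℝ × ℝ × ℝ)) : SmoothOn D (f p q s) := by
  rw [f_eq_expSum]
  exact expSum_smoothOn p q s D _

theorem g_smoothOn (D : Set (ℝ × ℝ × ℝ)) : SmoothOn D (g p q s) := by
  rw [g_eq_expSum]
  exact expSum_smoothOn p q s D _

theorem H_smoothOn (D : Set (ℝ × ℝ × ℝ)) : SmoothOn D (H p q s) := by
  rw [H_eq_expSum]
  exact expSum_smoothOn p q s D _

theorem wSol_smoothOn (σ c : ℂ) : SmoothOn (domV p q s) (wSol σ c p q s) := by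
  have hx : ContDiff ℝ ∞ fun y : ℝ × ℝ × ℝ => (y.1 : ℂ) :=
    Complex.ofRealCLM.contDiff.comp contDiff_fst
  have hR : SmoothOn (domV p q s) fun x z t => f p q s x z t * (g p q s x z t)⁻¹ :=
    ContDiffOn.mul (f_smoothOn _) (ContDiffOn.inv (g_smoothOn _) fun y hy => hy.2)
  have hPhi : SmoothOn (domV p q s) fun x z t => x + H p q s x z t * (f p q s x z t)⁻¹ :=
    ContDiffOn.add hx.contDiffOn
      (ContDiffOn.mul (H_smoothOn _) (ContDiffOn.inv (f_smoothOn _) fun y hy => hy.1))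
  have hR2 := ContDiffOn.pow hR 2
  exact ((contDiffOn_const (c := σ)).mul hR2).mul hPhi |>.add ((contDiffOn_const (c := c)).mul hR2)

theorem isOpen_domW (σ c : ℂ) : IsOpen (domW σ c p q s) :=
  ContinuousOn.isOpen_inter_preimage (ContDiffOn.continuousOn (wSol_smoothOn σ c))
    (isOpen_domV p q s) isOpen_ne

theorem domW_subset (σ c : ℂ) : domW σ c p q s ⊆ domV p q s := fun _ h => h.1

variable (hp : ∀ j, p j ≠ 0) (hpp : ∀ j k, j ≠ k → p j + p k ≠ 0)

include hp hpp

/-- Since w = (f/g)² (σΦ + c) and (f/g)² Φ_x = 1, w satisfies a linear first order equation in x,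
for every c. -/
theorem wSol_partialX (σ c : ℂ) : PartialX (domV p q s) (wSol σ c p q s)
    fun x z t => 2 * uFun p q s x z t * wSol σ c p q s x z t + σ := fun x z t h => by
  have h0 : f p q s x z t / g p q s x z t ≠ 0 := div_ne_zero h.1 h.2
  have h1 := (quotient_partialX hp hpp x z t h).fun_pow 2
  have h2 := Phi_partialX hp hpp x z t h
  refine (((h1.const_mul σ).fun_mul h2).fun_add (h1.const_mul c)).congr_deriv ?_
  simp only [wSol, _root_.zpow_neg, zpow_ofNat]
  set R := f p q s x z t / g p q s x z t
  norm_num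
  field_simp
  ring

theorem wSol_partialT (σ c : ℂ) : PartialT (domV p q s) (wSol σ c p q s)
    fun x z t => flowTrace p q s x z t * wSol σ c p q s x z t / 2
      + σ * tr₁ p q s (-1) q x z t := fun x z t h => by
  have h0 : f p q s x z t / g p q s x z t ≠ 0 := div_ne_zero h.1 h.2
  have h1 := (quotient_partialT hp hpp x z t h).fun_pow 2
  have h2 := Phi_partialT hp hpp x z t h
  refine (((h1.const_mul σ).fun_mul h2).fun_add (h1.const_mul c)).congr_deriv ?_
  simp only [wSol]
  set R := f p q s x z t / g p q s x z t
  norm_num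
  field_simp
  ring

theorem miura_wSol {σ : ℂ} (c : ℂ) (hσ : σ ^ 2 = -1) {x z t : ℝ}
    (h : (x, z, t) ∈ domW σ c p q s) :
    miura σ (wSol σ c p q s) x z t = -vSol σ p q s x z t := by
  have h0 : wSol σ c p q s x z t ≠ 0 := h.2
  rw [miura, (wSol_partialX hp hpp σ c).dx_eq x z t h.1]
  change _ = -(σ * uFun p q s x z t)
  field_simp
  linear_combination -hσ

/-- Every primitive of `(1 / w²)_z` gives a solution. -/
theorem wSol_solvesCKdV {σ : ℂ} (c : ℂ) (hσ : σ ^ 2 = -1) {A : ℝ → ℝ → ℝ → ℂ}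
    (hA : IsXPrimitiveOn (domW σ c p q s) (dz fun x z t => 1 / wSol σ c p q s x z t ^ 2) A) :
    SolvesCKdV (domW σ c p q s) (wSol σ c p q s) A fun x z t =>
      A x z t - 4 * CFun p q s x z t
        - 2 * σ * dz (fun x z t => (wSol σ c p q s x z t)⁻¹) x z t :=
  ((flowData hp hpp).mono (isOpen_domW σ c) (domW_subset σ c)).solvesCKdV
    (b := tr₁ p q s (-1) q) hσ
    (ContDiffOn.mono (wSol_smoothOn σ c) (domW_subset σ c)) (fun _ _ _ h => h.2)
    (fun x z t h => wSol_partialX hp hpp σ c x z t h.1)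
    (fun x z t h => wSol_partialT hp hpp σ c x z t h.1)
    (fun x z t h => by
      rw [CFun_eq hp hpp h.1]
      ring) hA

end Solution

/-! ### Asymptotics of the solution -/

section SolutionAsymptotics

variable {N : ℕ} {p q s : Fin N → ℂ}

theorem etaProd_ne_zero (hpp : ∀ j k, j ≠ k → p j + p k ≠ 0) (hinj : Function.Injective p)
    (S : Finset (Fin N)) : etaProd p S ≠ 0 := by
  refine Finset.prod_ne_zero_iff.2 fun j _ => Finset.prod_ne_zero_iff.2 fun k hk => ?_
  have hjk : j ≠ k := (Finset.mem_filter.1 hk).2.ne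
  exact div_ne_zero (pow_ne_zero 2 (sub_ne_zero.2 (hinj.ne hjk))) (pow_ne_zero 2 (hpp j k hjk))

theorem signed_etaProd_ne_zero (hpp : ∀ j k, j ≠ k → p j + p k ≠ 0)
    (hinj : Function.Injective p) (S : Finset (Fin N)) : (-1) ^ S.card * etaProd p S ≠ 0 :=
  mul_ne_zero (pow_ne_zero _ (neg_ne_zero.2 one_ne_zero)) (etaProd_ne_zero hpp hinj S)

theorem hasDerivAt_wSol_z (σ c : ℂ) {x z t : ℝ} (h : (x, z, t) ∈ domV p q s) :
    HasDerivAt (fun z' => wSol σ c p q s x z' t) (dz (wSol σ c p q s) x z t) z :=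
  (wSol_smoothOn σ c).partialZ (isOpen_domV p q s) x z t h

/-- The `z` derivative of `f / g`. -/
def quotientZ (p q s : Fin N → ℂ) (x z t : ℝ) : ℂ :=
  (expSum p q s (fun S => (∑ i ∈ S, q i) * etaProd p S) x z t * g p q s x z t
    - f p q s x z t
      * expSum p q s (fun S => (∑ i ∈ S, q i) * ((-1) ^ S.card * etaProd p S)) x z t)
    / g p q s x z t ^ 2

/-- The `z` derivative of `H / f`. -/
def PhiZ (p q s : Fin N → ℂ) (x z t : ℝ) : ℂ :=
  (expSum p q s (fun S => (∑ i ∈ S, q i) * (4 * ∑ n ∈ Finset.univ \ S, etaProd p S / p n)) x z t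
      * f p q s x z t
    - H p q s x z t * expSum p q s (fun S => (∑ i ∈ S, q i) * etaProd p S) x z t)
    / f p q s x z t ^ 2

theorem dz_wSol (σ c : ℂ) {x z t : ℝ} (h : (x, z, t) ∈ domV p q s) :
    dz (wSol σ c p q s) x z t
      = 2 * (f p q s x z t / g p q s x z t) * quotientZ p q s x z t * (σ * Phi p q s x z t + c)
        + (f p q s x z t / g p q s x z t) ^ 2 * (σ * PhiZ p q s x z t) := by
  have hf := expSum_hasDerivAt_z p q s (etaProd p) x z t
  have hg := expSum_hasDerivAt_z p q s (fun S => (-1) ^ S.card * etaProd p S) x z t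
  have hH := expSum_hasDerivAt_z p q s
    (fun S => 4 * ∑ n ∈ Finset.univ \ S, etaProd p S / p n) x z t
  rw [← f_eq_expSum] at hf
  rw [← g_eq_expSum] at hg
  rw [← H_eq_expSum] at hH
  have h1 := (hf.fun_div hg h.2).fun_pow 2
  have h2 := (hH.fun_div hf h.1).const_add (x : ℂ)
  have h3 := ((h1.const_mul σ).fun_mul h2).fun_add (h1.const_mul c)
  refine h3.deriv.trans ?_
  rw [quotientZ, PhiZ, Phi]
  norm_num
  ring

theorem one_div_wSol_sq_smoothOn (σ c : ℂ) :
    SmoothOn (domW σ c p q s) fun x z t => 1 / wSol σ c p q s x z t ^ 2 := by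
  have h1 := ContDiffOn.inv (ContDiffOn.pow
    (ContDiffOn.mono (wSol_smoothOn (p := p) (q := q) (s := s) σ c) (domW_subset σ c)) 2)
    fun y hy => pow_ne_zero 2 hy.2
  exact h1.congr fun y _ => one_div _

/-- A continuous function on an open set has a primitive in `x`, which vanishes at `-∞` if the
function decays. -/
theorem exists_xPrimitive {D : Set (ℝ × ℝ × ℝ)} (hD : IsOpen D) {u : ℝ → ℝ → ℝ → ℂ}
    (hu : SmoothOn D u) : ∃ A : ℝ → ℝ → ℝ → ℂ, IsXPrimitiveOn D u A ∧
      ∀ z t, (∀ᶠ x : ℝ in atBot, (x, z, t) ∈ D) →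
        ((fun x : ℝ => u x z t) =O[atBot] fun x : ℝ => (1 + x ^ 2)⁻¹) →
        Tendsto (fun x => A x z t) atBot (𝓝 0) := by
  have key : ∀ z t : ℝ, ∃ A : ℝ → ℂ,
      (∀ x ∈ (fun x : ℝ => (x, z, t)) ⁻¹' D, HasDerivAt A (u x z t) x) ∧
      ((∀ᶠ x in atBot, x ∈ (fun x : ℝ => (x, z, t)) ⁻¹' D) →
        ((fun x : ℝ => u x z t) =O[atBot] fun x : ℝ => (1 + x ^ 2)⁻¹) →
        Tendsto A atBot (𝓝 0)) := fun z t => by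
    have hline : Continuous fun x : ℝ => (x, z, t) := by fun_prop
    have hc : ContinuousOn (fun x : ℝ => u x z t) ((fun x : ℝ => (x, z, t)) ⁻¹' D) :=
      (ContDiffOn.continuousOn hu).comp hline.continuousOn (Set.mapsTo_preimage _ _)
    exact exists_primitive (hD.preimage hline) hc
  choose A hA hA0 using key
  exact ⟨fun x z t => A z t x, fun x z t h => hA z t x h, fun z t => hA0 z t⟩

variable (hre : ∀ j, (p j).re ≠ 0) (hpp : ∀ j k, j ≠ k → p j + p k ≠ 0)
  (hinj : Function.Injective p)

include hre hpp hinj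

theorem eventually_mem_domV (z t : ℝ) : ∀ᶠ x : ℝ in atBot, (x, z, t) ∈ domV p q s := by
  have h1 := eventually_expSum_ne_zero (q := q) (s := s) hre
    (etaProd_ne_zero hpp hinj (domSet p)) z t
  have h2 := eventually_expSum_ne_zero (q := q) (s := s) hre
    (a := fun S => (-1) ^ S.card * etaProd p S) (signed_etaProd_ne_zero hpp hinj _) z t
  rw [← f_eq_expSum] at h1
  rw [← g_eq_expSum] at h2
  exact h1.and h2

theorem CFun_vanishesAtLeft : VanishesAtLeft (CFun p q s) := by
  intro z t
  have h1 := tendsto_log_xz (q := q) (s := s) hre (etaProd_ne_zero hpp hinj (domSet p)) z t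
  have h2 := tendsto_log_xz (q := q) (s := s) hre
    (a := fun S => (-1) ^ S.card * etaProd p S) (signed_etaProd_ne_zero hpp hinj _) z t
  rw [← f_eq_expSum] at h1
  rw [← g_eq_expSum] at h2
  have h3 := h1.add h2
  rw [add_zero] at h3
  exact h3

theorem tendsto_quotient_fg (z t : ℝ) :
    Tendsto (fun x : ℝ => f p q s x z t / g p q s x z t) atBot
      (𝓝 ((-1) ^ (domSet p).card)) := by
  have h1 := tendsto_quotient (q := q) (s := s) hre (etaProd p)
    (b := fun S => (-1) ^ S.card * etaProd p S) (signed_etaProd_ne_zero hpp hinj (domSet p)) z t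
  have h2 : etaProd p (domSet p) / ((-1) ^ (domSet p).card * etaProd p (domSet p))
      = (-1) ^ (domSet p).card := by
    have := etaProd_ne_zero hpp hinj (domSet p)
    have h3 : ((-1 : ℂ) ^ (domSet p).card) * (-1) ^ (domSet p).card = 1 := by
      rw [← mul_pow]
      norm_num
    rw [div_eq_iff (signed_etaProd_ne_zero hpp hinj _), ← mul_assoc, h3, one_mul]
  rw [h2] at h1
  rw [f_eq_expSum, g_eq_expSum]
  exact h1

theorem tendsto_Phi_div (z t : ℝ) :
    Tendsto (fun x : ℝ => Phi p q s x z t * (x : ℂ)⁻¹) atBot (𝓝 1) := by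
  have h1 := (tendsto_quotient (q := q) (s := s) hre
    (fun S => 4 * ∑ n ∈ Finset.univ \ S, etaProd p S / p n)
    (etaProd_ne_zero hpp hinj (domSet p)) z t).mul tendsto_ofReal_inv_atBot
  rw [← f_eq_expSum, ← H_eq_expSum, mul_zero] at h1
  have h2 := h1.const_add 1
  rw [add_zero] at h2
  refine h2.congr' ?_
  filter_upwards [eventually_lt_atBot 0] with x hx
  have : (x : ℂ) ≠ 0 := by exact_mod_cast hx.ne
  rw [Phi, add_mul, mul_inv_cancel₀ this]

theorem tendsto_wSol_div (σ c : ℂ) (z t : ℝ) :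
    Tendsto (fun x : ℝ => wSol σ c p q s x z t * (x : ℂ)⁻¹) atBot (𝓝 σ) := by
  have h1 := (tendsto_quotient_fg (q := q) (s := s) hre hpp hinj z t).pow 2
  have h2 : ((-1 : ℂ) ^ (domSet p).card) ^ 2 = 1 := by
    rw [← pow_mul, mul_comm, pow_mul]
    norm_num
  rw [h2] at h1
  have h3 := ((h1.const_mul σ).mul (tendsto_Phi_div (q := q) (s := s) hre hpp hinj z t)).add
    ((h1.const_mul c).mul tendsto_ofReal_inv_atBot)
  simp only [mul_one, mul_zero, add_zero] at h3
  refine h3.congr fun x => ?_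
  rw [wSol]
  ring

theorem eventually_mem_domW {σ : ℂ} (hσ : σ ≠ 0) (c : ℂ) (z t : ℝ) :
    ∀ᶠ x : ℝ in atBot, (x, z, t) ∈ domW σ c p q s := by
  filter_upwards [eventually_mem_domV (q := q) (s := s) hre hpp hinj z t,
    (tendsto_wSol_div (q := q) (s := s) hre hpp hinj σ c z t).eventually_ne hσ] with x h1 h2
  exact ⟨h1, left_ne_zero_of_mul h2⟩

/-- The growth of Φ ~ x is harmless because (f/g)_z is o(1/x). -/
theorem tendsto_dz_wSol (σ c : ℂ) (z t : ℝ) :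
    Tendsto (fun x : ℝ => dz (wSol σ c p q s) x z t) atBot (𝓝 0) := by
  have h1 := tendsto_quotient_fg (q := q) (s := s) hre hpp hinj z t
  have h2 := tendsto_mul_quotient_z (q := q) (s := s) hre (etaProd p)
    (b := fun S => (-1) ^ S.card * etaProd p S) (signed_etaProd_ne_zero hpp hinj (domSet p)) z t
  have h3 := tendsto_mul_quotient_z (q := q) (s := s) hre
    (fun S => 4 * ∑ n ∈ Finset.univ \ S, etaProd p S / p n)
    (etaProd_ne_zero hpp hinj (domSet p)) z t
  rw [← f_eq_expSum] at h2 h3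
  rw [← H_eq_expSum] at h3
  rw [← g_eq_expSum] at h2
  have h4 := tendsto_Phi_div (q := q) (s := s) hre hpp hinj z t
  have h5 := tendsto_ofReal_inv_atBot
  have h6 := (((h1.const_mul 2).mul h2).mul ((h4.const_mul σ).add (h5.const_mul c))).add
    ((h1.pow 2).mul ((h5.mul h3).const_mul σ))
  simp only [mul_zero, zero_mul, add_zero] at h6
  refine h6.congr' ?_
  filter_upwards [eventually_lt_atBot 0,
    eventually_mem_domV (q := q) (s := s) hre hpp hinj z t] with x hx hmem
  have hx0 : (x : ℂ) ≠ 0 := by exact_mod_cast hx.ne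
  rw [dz_wSol σ c hmem]
  change 2 * (f p q s x z t / g p q s x z t) * (x * quotientZ p q s x z t)
      * (σ * (Phi p q s x z t * (x : ℂ)⁻¹) + c * (x : ℂ)⁻¹)
    + (f p q s x z t / g p q s x z t) ^ 2 * (σ * ((x : ℂ)⁻¹ * (x * PhiZ p q s x z t))) = _
  field_simp

theorem tendsto_inv_wSol {σ : ℂ} (hσ : σ ≠ 0) (c : ℂ) (z t : ℝ) :
    Tendsto (fun x : ℝ => (wSol σ c p q s x z t)⁻¹) atBot (𝓝 0) := by
  have h1 := ((tendsto_wSol_div (q := q) (s := s) hre hpp hinj σ c z t).inv₀ hσ).mul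
    tendsto_ofReal_inv_atBot
  rw [mul_zero] at h1
  refine h1.congr' ?_
  filter_upwards [eventually_lt_atBot 0] with x hx
  have hx0 : (x : ℂ) ≠ 0 := by exact_mod_cast hx.ne
  rw [mul_inv, inv_inv, mul_assoc, mul_inv_cancel₀ hx0, mul_one]

theorem tendsto_dz_inv_wSol {σ : ℂ} (hσ : σ ≠ 0) (c : ℂ) (z t : ℝ) :
    Tendsto (fun x : ℝ => dz (fun x z t => (wSol σ c p q s x z t)⁻¹) x z t) atBot (𝓝 0) := by
  have h1 := ((tendsto_dz_wSol (q := q) (s := s) hre hpp hinj σ c z t).mul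
    ((tendsto_inv_wSol (q := q) (s := s) hre hpp hinj hσ c z t).pow 2)).neg
  simp only [zero_mul, neg_zero] at h1
  refine h1.congr' ?_
  filter_upwards [eventually_mem_domW (q := q) (s := s) hre hpp hinj hσ c z t] with x hx
  refine Eq.trans ?_ ((hasDerivAt_wSol_z σ c hx.1).inv hx.2).deriv.symm
  rw [inv_pow, neg_div, div_eq_mul_inv]

theorem dz_inv_wSol_sq_isBigO {σ : ℂ} (hσ : σ ≠ 0) (c : ℂ) (z t : ℝ) :
    (fun x : ℝ => dz (fun x z t => 1 / wSol σ c p q s x z t ^ 2) x z t) =O[atBot]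
      fun x : ℝ => (1 + x ^ 2)⁻¹ := by
  have h1 := tendsto_dz_wSol (q := q) (s := s) hre hpp hinj σ c z t
  have h2 := tendsto_inv_wSol (q := q) (s := s) hre hpp hinj hσ c z t
  have h3 := (tendsto_wSol_div (q := q) (s := s) hre hpp hinj σ c z t).inv₀ hσ
  -- This product is (1 + x²)(1/w²)_z, written as -2 (w_z/w)(1/w² + (x/w)²): the first factor tends
  -- to 0 and the second stays bounded.
  have h4 := ((h1.mul h2).const_mul (-2)).mul ((h2.pow 2).add (h3.pow 2))
  simp only [mul_zero, zero_mul] at h4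
  refine Asymptotics.IsBigO.of_bound 1 ?_
  filter_upwards [eventually_lt_atBot 0, h4.norm.eventually_lt_const (u := 1) (by simp),
    eventually_mem_domW (q := q) (s := s) hre hpp hinj hσ c z t] with x hx hb hmem
  have hx0 : (x : ℂ) ≠ 0 := by exact_mod_cast hx.ne
  have hw0 : wSol σ c p q s x z t ≠ 0 := hmem.2
  have e1 : dz (fun x z t => 1 / wSol σ c p q s x z t ^ 2) x z t
      = -2 * dz (wSol σ c p q s) x z t / wSol σ c p q s x z t ^ 3 := by
    have h5 := ((hasDerivAt_wSol_z σ c hmem.1).fun_pow 2).fun_inv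
      (pow_ne_zero 2 hw0)
    simp only [← one_div] at h5
    refine h5.deriv.trans ?_
    norm_num
    field_simp
  have e2 : -2 * (dz (wSol σ c p q s) x z t * (wSol σ c p q s x z t)⁻¹)
        * ((wSol σ c p q s x z t)⁻¹ ^ 2 + (wSol σ c p q s x z t * (x : ℂ)⁻¹)⁻¹ ^ 2)
      = dz (fun x z t => 1 / wSol σ c p q s x z t ^ 2) x z t * ((1 + x ^ 2 : ℝ) : ℂ) := by
    rw [e1]
    push_cast
    field_simp
  rw [e2, norm_mul, Complex.norm_real] at hb
  rw [one_mul, norm_inv, ← one_div]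
  have h6 : 0 < ‖1 + x ^ 2‖ := norm_pos_iff.2 (by positivity)
  exact ((lt_div_iff₀ h6).2 hb).le

end SolutionAsymptotics

end CKdV
end

theorem mainTheorem7 (N : ℕ) (σ c : ℂ) (hσ : σ = Complex.I ∨ σ = -Complex.I)
    (p q s : Fin N → ℂ) (hp : ∀ j, p j ≠ 0) (hpp : ∀ j k, j ≠ k → p j + p k ≠ 0) :
    -- the function `x + H/f` is the integral of `(f/g)⁻²` in the formula for `w`
    (∀ x z t : ℝ, (x, z, t) ∈ CKdV.domV p q s →
      HasDerivAt (fun x' : ℝ => CKdV.Phi p q s x' z t)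
        ((CKdV.f p q s x z t / CKdV.g p q s x z t) ^ (-2 : ℤ)) x) ∧
    -- `v` and `-v` are solutions of mCBS
    (∃ C : ℝ → ℝ → ℝ → ℂ,
      CKdV.SolvesMCBS (CKdV.domV p q s) (CKdV.vSol σ p q s) C ∧
      CKdV.SolvesMCBS (CKdV.domV p q s) (fun x z t => -CKdV.vSol σ p q s x z t) C ∧
      ((∀ j, (p j).re ≠ 0) → Function.Injective p → CKdV.VanishesAtLeft C)) ∧
    -- the Miura type transformation maps `w` to `-v`
    (∀ x z t : ℝ, (x, z, t) ∈ CKdV.domW σ c p q s →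
      CKdV.miura σ (CKdV.wSol σ c p q s) x z t = -CKdV.vSol σ p q s x z t) ∧
    -- `w` is a solution of the (2+1)-dimensional CKdV equation
    (∃ A B : ℝ → ℝ → ℝ → ℂ,
      CKdV.SolvesCKdV (CKdV.domW σ c p q s) (CKdV.wSol σ c p q s) A B ∧
      ((∀ j, (p j).re ≠ 0) → Function.Injective p →
        CKdV.VanishesAtLeft A ∧ CKdV.VanishesAtLeft B ∧
        ∀ z t : ℝ, ∀ᶠ x : ℝ in Filter.atBot, (x, z, t) ∈ CKdV.domW σ c p q s)) := by
  have hσ2 : σ ^ 2 = -1 := by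
    rcases hσ with rfl | rfl
    · exact Complex.I_sq
    · rw [neg_sq, Complex.I_sq]
  have hσ0 : σ ≠ 0 := fun h => by norm_num [h] at hσ2
  have hflow := CKdV.flowData (q := q) (s := s) hp hpp
  refine ⟨CKdV.Phi_partialX hp hpp, ⟨CKdV.CFun p q s, hflow.solvesMCBS hσ2, ?_,
    fun hre hinj => CKdV.CFun_vanishesAtLeft hre hpp hinj⟩,
    fun x z t h => CKdV.miura_wSol hp hpp c hσ2 h, ?_⟩
  · have h := hflow.solvesMCBS (σ := -σ) (by rw [neg_sq, hσ2])
    simp only [neg_mul] at h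
    exact h
  · obtain ⟨A, hA, hA0⟩ := CKdV.exists_xPrimitive (CKdV.isOpen_domW σ c)
      ((CKdV.one_div_wSol_sq_smoothOn (p := p) (q := q) (s := s) σ c).dz
        (CKdV.isOpen_domW σ c))
    refine ⟨A, _, CKdV.wSol_solvesCKdV hp hpp c hσ2 hA, fun hre hinj => ?_⟩
    have hev := fun z t =>
      CKdV.eventually_mem_domW (q := q) (s := s) hre hpp hinj hσ0 c z t
    have hAlim : CKdV.VanishesAtLeft A := fun z t =>
      hA0 z t (hev z t) (CKdV.dz_inv_wSol_sq_isBigO hre hpp hinj hσ0 c z t)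
    refine ⟨hAlim, fun z t => ?_, hev⟩
    -- The second antiderivative is A - 4C - 2σ (1/w)_z, and each of the three terms vanishes at -∞.
    have h1 := ((hAlim z t).sub ((CKdV.CFun_vanishesAtLeft (q := q) (s := s) hre hpp hinj
      z t).const_mul 4)).sub
        ((CKdV.tendsto_dz_inv_wSol (q := q) (s := s) hre hpp hinj hσ0 c z t).const_mul (2 * σ))
    simpa only [mul_zero, sub_zero] using h1
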